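/- Let $T>0$, let $(\Omega,\mathcal F,P)$ be a probability space carrying a one-dimensional Brownian motion $(B_t)_{0\le t\le T}$, and let $I_n:L^2([0,T]^n)\to L^2(\Omega)$ denote the $n$-th order multiple Itô integral with respect to $B$ ($I_0$ is the identity on constants). For $\lambda\ge 1$ let $\mathcal G_\lambda$ be the set of all $X\in L^2(\Omega)$ that have a chaos expansion $X=\sum_{n\ge 0} I_n(h_n)$ (convergence in $L^2(\Omega)$) with symmetric kernels $h_n\in L^2([0,T]^n)$ such that $\sum_{n\ge 0} n!\,\lambda^{2n}\|h_n\|^2_{L^2([0,T]^n)}<\infty$. For such $X$ put $\Gamma(\lambda)X=\sum_{n\ge0}\lambda^n I_n(h_n)$ and $\|X\|_{\mathcal G_\lambda}=\|\Gamma(\lambda)X\|_{L^2(\Omega)}$. The $n$-th order Hida–Malliavin derivative of $X$ at $t=(t_1,\dots,t_n)\in[0,T]^n$ is $$D^n_tX=\sum_{k\ge n}k(k-1)\cdots(k-n+1)\,I_{k-n}\big(h_k(\cdot,t_1,\dots,t_n)\big),\qquad D^0X=X .$$ **Lemma 3.4.** Let $X,Y\in\mathcal G_{\sqrt2}$. Then,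 for every $n\ge 0$, the series defining $D^n_tX$ and $D^n_tY$ converge in $L^2(\Omega)$ for almost every $t\in[0,T]^n$, and $t\mapsto D^n_tX\cdot D^n_tY$ is an integrable $L^1(\Omega)$-valued function on $[0,T]^n$. The series $$\sum_{n\ge 0}\frac1{n!}\int_{[0,T]^n}D^n_tX\cdot D^n_tY\,dt$$ converges (unconditionally) in $L^1(\Omega)$, and $$\Big\|\sum_{n\ge 0}\frac1{n!}\int_{[0,T]^n}D^n_tX\cdot D^n_tY\,dt\Big\|_{L^1(\Omega)}\le\|X\|_{\mathcal G_{\sqrt2}}\,\|Y\|_{\mathcal G_{\sqrt2}} .$$ -/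

import Mathlib

open MeasureTheory ProbabilityTheory

noncomputable section

namespace WienerChaos

/-- A (standard, one-dimensional) Brownian motion on the time interval `[0, T]`. -/
structure IsBrownianMotionOn {Ω : Type*} [MeasurableSpace Ω] (T : ℝ)
    (B : Set.Icc (0 : ℝ) T → Ω → ℝ) (P : Measure Ω) : Prop where
  start_zero : ∀ t : Set.Icc (0 : ℝ) T, (t : ℝ) = 0 → ∀ᵐ ω ∂P, B t ω = 0
  indep_increments : HasIndepIncrements B P
  gaussian_increments : ∀ s t : Set.Icc (0 : ℝ) T, s ≤ t →
    HasLaw (fun ω => B t ω - B s ω) (gaussianReal 0 (Real.toNNReal ((t : ℝ) - (s : ℝ)))) P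
  continuous_paths : ∀ᵐ ω ∂P, Continuous fun t => B t ω

/-- Lebesgue measure on the cube `[0, T]^n` (for `n = 0`: the unit mass on the one-point space). -/
def cube (T : ℝ) (n : ℕ) : Measure (Fin n → ℝ) :=
  Measure.pi fun _ => (volume : Measure ℝ).restrict (Set.Icc 0 T)

instance (T : ℝ) (n : ℕ) : IsFiniteMeasure (cube T n) := by
  unfold cube; infer_instance

/-- The class in `L²(μ)` of a function (set to `0` if the function is not square integrable). -/
def toL2 {α : Type*} [MeasurableSpace α] (μ : Measure α) (f : α → ℝ) : Lp ℝ 2 μ :=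
  open Classical in if hf : MemLp f 2 μ then hf.toLp f else 0

/-! ### Multiple Itô integrals -/

/-- A box `(a₁, b₁] × ⋯ × (aₙ, bₙ]` in `[0, T]^n` with pairwise disjoint sides; such a box does
not meet the diagonals `tᵢ = tⱼ`, `i ≠ j`. -/
structure OffDiagBox (T : ℝ) (n : ℕ) where
  left : Fin n → Set.Icc (0 : ℝ) T
  right : Fin n → Set.Icc (0 : ℝ) T
  left_le_right : ∀ i, left i ≤ right i
  disjoint_sides : Pairwise fun i j =>
    Disjoint (Set.Ioc (left i : ℝ) (right i : ℝ)) (Set.Ioc (left j : ℝ) (right j : ℝ))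

/-- The box as a subset of `ℝ^n`. -/
def OffDiagBox.toSet {T : ℝ} {n : ℕ} (b : OffDiagBox T n) : Set (Fin n → ℝ) :=
  Set.univ.pi fun i => Set.Ioc (b.left i : ℝ) (b.right i : ℝ)

lemma OffDiagBox.measurableSet_toSet {T : ℝ} {n : ℕ} (b : OffDiagBox T n) :
    MeasurableSet b.toSet :=
  MeasurableSet.univ_pi fun _ => measurableSet_Ioc

/-- The elementary function `∑ c_b 1_b ∈ L²([0, T]^n)` attached to a formal finite linear
combination of off-diagonal boxes. -/
def elementaryFunction (T : ℝ) (n : ℕ) : (OffDiagBox T n →₀ ℝ) →ₗ[ℝ] Lp ℝ 2 (cube T n) :=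
  Finsupp.linearCombination ℝ fun b =>
    indicatorConstLp 2 b.measurableSet_toSet (measure_ne_top (cube T n) b.toSet) (1 : ℝ)

/-- The multiple integral of an elementary function:
`∑ c_b ∏ i, (B (bᵢ) - B (aᵢ)) ∈ L²(Ω)` for `∑ c_b 1_b` with `b = (a₁, b₁] × ⋯ × (aₙ, bₙ]`. -/
def elementaryIntegral {Ω : Type*} [MeasurableSpace Ω] {T : ℝ}
    (B : Set.Icc (0 : ℝ) T → Ω → ℝ) (P : Measure Ω) (n : ℕ) :
    (OffDiagBox T n →₀ ℝ) →ₗ[ℝ] Lp ℝ 2 P :=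
  Finsupp.linearCombination ℝ fun b =>
    toL2 P fun ω => ∏ i, (B (b.right i) ω - B (b.left i) ω)

/-- The `n`-th order multiple Itô integral `Iₙ : L²([0, T]^n) → L²(Ω)` with respect to `B`: the
continuous linear extension of the integral of elementary functions. Elementary functions are
dense, and for a Brownian motion the elementary integral is bounded for the `L²` norms, so the
extension exists and is unique. For `n = 0` it maps a constant to itself. -/
def multipleIntegral {Ω : Type*} [MeasurableSpace Ω] {T : ℝ}
    (B : Set.Icc (0 : ℝ) T → Ω → ℝ) (P : Measure Ω) (n : ℕ) :
    Lp ℝ 2 (cube T n) →L[ℝ] Lp ℝ 2 P :=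
  (elementaryIntegral B P n).extendOfNorm (elementaryFunction T n)

/-! ### Chaos expansions and the spaces `𝒢_λ` -/

/-- A kernel in `L²([0, T]^n)` is symmetric in its `n` variables. -/
def IsSymmetric {T : ℝ} {n : ℕ} (h : Lp ℝ 2 (cube T n)) : Prop :=
  ∀ σ : Equiv.Perm (Fin n), (fun t => h (t ∘ σ)) =ᵐ[cube T n] h

/-- `X = ∑ Iₙ(hₙ)` in `L²(Ω)`, with symmetric kernels `hₙ ∈ L²([0, T]^n)`. -/
def IsChaosExpansion {Ω : Type*} [MeasurableSpace Ω] {T : ℝ}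
    (B : Set.Icc (0 : ℝ) T → Ω → ℝ) (P : Measure Ω) (X : Lp ℝ 2 P)
    (h : ∀ n : ℕ, Lp ℝ 2 (cube T n)) : Prop :=
  (∀ n, IsSymmetric (h n)) ∧ HasSum (fun n => multipleIntegral B P n (h n)) X

/-- The kernels `hₙ` of the (unique) Wiener–Itô chaos expansion of `X` (set to `0` if `X` has
none). -/
def chaosKernel {Ω : Type*} [MeasurableSpace Ω] {T : ℝ}
    (B : Set.Icc (0 : ℝ) T → Ω → ℝ) (P : Measure Ω) (X : Lp ℝ 2 P) :
    ∀ n : ℕ, Lp ℝ 2 (cube T n) :=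
  open Classical in if hX : ∃ h, IsChaosExpansion B P X h then hX.choose else 0

/-- `X ∈ 𝒢_λ`: `X = ∑ Iₙ(hₙ)` with `∑ n! λ^(2n) |hₙ|² < ∞`. -/
def MemG {Ω : Type*} [MeasurableSpace Ω] {T : ℝ}
    (B : Set.Icc (0 : ℝ) T → Ω → ℝ) (P : Measure Ω) (lam : ℝ) (X : Lp ℝ 2 P) : Prop :=
  ∃ h, IsChaosExpansion B P X h ∧
    Summable fun n : ℕ => (n.factorial : ℝ) * lam ^ (2 * n) * ‖h n‖ ^ 2

/-- The second quantization `Γ(λ) = Γ(λ I)`: `Γ(λ) ∑ Iₙ(hₙ) = ∑ Iₙ((λ I)^{⊗n} hₙ)`, where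
`(λ I)^{⊗n} hₙ = λ^n hₙ`. -/
def secondQuantization {Ω : Type*} [MeasurableSpace Ω] {T : ℝ}
    (B : Set.Icc (0 : ℝ) T → Ω → ℝ) (P : Measure Ω) (lam : ℝ) (X : Lp ℝ 2 P) : Lp ℝ 2 P :=
  ∑' n : ℕ, multipleIntegral B P n (lam ^ n • chaosKernel B P X n)

/-- The norm `‖X‖_{𝒢_λ} = ‖Γ(λ) X‖₂` of an element of `𝒢_λ`. -/
def normG {Ω : Type*} [MeasurableSpace Ω] {T : ℝ}
    (B : Set.Icc (0 : ℝ) T → Ω → ℝ) (P : Measure Ω) (lam : ℝ) (X : Lp ℝ 2 P) : ℝ :=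
  ‖secondQuantization B P lam X‖

/-! ### Hida–Malliavin derivatives -/

/-- The section `h(·, t₁, …, tₙ) ∈ L²([0, T]^m)` of a kernel `h ∈ L²([0, T]^(m+n))`
(square integrable for almost every `t`). -/
def kernelSection {T : ℝ} {m n : ℕ} (h : Lp ℝ 2 (cube T (m + n))) (t : Fin n → ℝ) :
    Lp ℝ 2 (cube T m) :=
  toL2 (cube T m) fun s => h (Fin.append s t)

/-- The term of index `k = m + n` of the series that defines `Dⁿ_{t₁,…,tₙ} X`, namely
`k (k-1) ⋯ (k-n+1) I_{k-n}(h_k(·, t₁, …, tₙ))`. -/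
def derivTerm {Ω : Type*} [MeasurableSpace Ω] {T : ℝ}
    (B : Set.Icc (0 : ℝ) T → Ω → ℝ) (P : Measure Ω) (X : Lp ℝ 2 P) (n : ℕ) (t : Fin n → ℝ)
    (m : ℕ) : Lp ℝ 2 P :=
  ((m + n).descFactorial n : ℝ) •
    multipleIntegral B P m (kernelSection (chaosKernel B P X (m + n)) t)

/-- The `n`-th order Hida–Malliavin derivative
`Dⁿ_{t₁,…,tₙ} X = ∑_{k ≥ n} k (k-1) ⋯ (k-n+1) I_{k-n}(h_k(·, t₁, …, tₙ))`, a series in `L²(Ω)`.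
For `n = 0` it is the chaos expansion of `X`, that is, `D⁰ X = X`. -/
def malliavinDeriv {Ω : Type*} [MeasurableSpace Ω] {T : ℝ}
    (B : Set.Icc (0 : ℝ) T → Ω → ℝ) (P : Measure Ω) (X : Lp ℝ 2 P) (n : ℕ) (t : Fin n → ℝ) :
    Lp ℝ 2 P :=
  ∑' m : ℕ, derivTerm B P X n t m

/-- The random variable `Dⁿ_{t₁,…,tₙ} X · Dⁿ_{t₁,…,tₙ} Y ∈ L¹(Ω)`. -/
def derivProduct {Ω : Type*} [MeasurableSpace Ω] {T : ℝ}
    (B : Set.Icc (0 : ℝ) T → Ω → ℝ) (P : Measure Ω) (X Y : Lp ℝ 2 P) (n : ℕ) (t : Fin n → ℝ) :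
    Lp ℝ 1 P :=
  (ContinuousLinearMap.mul ℝ ℝ).holder 1 (malliavinDeriv B P X n t) (malliavinDeriv B P Y n t)

/-- The `n`-th term `(1/n!) ∫_{[0,T]^n} Dⁿ_t X · Dⁿ_t Y dt` of the anti-Wick series, where the
integral is that of the `L¹(Ω)`-valued function `t ↦ Dⁿ_t X · Dⁿ_t Y`. -/
def antiWickTerm {Ω : Type*} [MeasurableSpace Ω] {T : ℝ}
    (B : Set.Icc (0 : ℝ) T → Ω → ℝ) (P : Measure Ω) (X Y : Lp ℝ 2 P) (n : ℕ) : Lp ℝ 1 P :=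
  (1 / (n.factorial : ℝ)) • ∫ t, derivProduct B P X Y n t ∂(cube T n)

end WienerChaos

end

open WienerChaos

/-! The heart of the matter is the identity `∑ₙ (1/n!) ∫ ‖Dⁿ_t X‖² dt = ‖X‖²` with the norm of
`𝒢_√2` on the right. By the Itô isometry and Tonelli, the kernel of order `k` contributes
`(k!/(k-n)!)² (k-n)! ‖h_k‖² = n! k! C(k,n) ‖h_k‖²` to `∫ ‖Dⁿ_t X‖² dt`; after division by `n!`,
summing over `n ≤ k` gives `2^k k! ‖h_k‖²`, and `2^k = (√2)^(2k)` (`MemG.tsum_derivEnergy`).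
Finiteness of this sum yields the almost everywhere convergence of the derivative series. Three
applications of Cauchy–Schwarz, in `Ω`, in `t` (`MemG.norm_antiWickTerm_le`) and in `n`, then give
absolute convergence and the bound.

The isometry and the orthogonality of different orders are first proved for boxes. Two off-diagonal
boxes are refined to a common time grid; their increment products become multilinear forms in
independent centred variables whose monomials are square-free, hence orthogonal unless they use the
same variables. Both statements pass to all of `L²` because elementary functions are dense
(`denseRange_elementaryFunction`). -/

namespace WienerChaos

/-- A random variable all of whose moments are finite. -/
def HasAllMoments {Ω : Type*} [MeasurableSpace Ω] (P : Measure Ω) (f : Ω → ℝ) : Prop :=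
  ∀ p : NNReal, MemLp f p P

/-! ### Multilinear forms in independent centred variables -/

section Moments

variable {Ω : Type*} [MeasurableSpace Ω] {P : Measure Ω}

/-- Hölder with exponents `2p, 2p`. Closure under products removes any need to track exponents when
many increments are multiplied. -/
lemma HasAllMoments.mul {f g : Ω → ℝ} (hf : HasAllMoments P f) (hg : HasAllMoments P g) :
    HasAllMoments P (fun ω => f ω * g ω) := by
  intro p
  have : ENNReal.HolderTriple ((2 * p : NNReal) : ENNReal) ((2 * p : NNReal) : ENNReal) p := by
    constructor
    rcases eq_or_ne p 0 with rfl | hp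
    · simp
    · have h2 : (2 * p : NNReal) ≠ 0 := by positivity
      rw [← ENNReal.coe_inv h2, ← ENNReal.coe_inv hp, ← ENNReal.coe_add]
      congr 1
      field_simp
      norm_num
  exact MemLp.mul' (hg (2 * p)) (hf (2 * p))

lemma HasAllMoments.prod [IsFiniteMeasure P] {ι : Type*} {f : ι → Ω → ℝ} (s : Finset ι)
    (hf : ∀ i ∈ s, HasAllMoments P (f i)) : HasAllMoments P (fun ω => ∏ i ∈ s, f i ω) := by
  classical
  induction s using Finset.induction_on with
  | empty => intro p; simpa using memLp_const (1 : ℝ)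
  | insert a s ha ih =>
    simp only [Finset.prod_insert ha]
    exact (hf a (Finset.mem_insert_self a s)).mul
      (ih fun i hi => hf i (Finset.mem_insert_of_mem hi))

lemma HasAllMoments.integrable {f : Ω → ℝ} (hf : HasAllMoments P f) : Integrable f P :=
  memLp_one_iff_integrable.1 (by simpa using hf 1)

lemma HasAllMoments.memLp_two {f : Ω → ℝ} (hf : HasAllMoments P f) : MemLp f 2 P := by
  simpa using hf 2

/-- Products of independent centred variables over different index sets are orthogonal. -/
lemma integral_prod_mul_prod {X : ℕ → Ω → ℝ} (hX : iIndepFun X P)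
    (hm : ∀ k, HasAllMoments P (X k)) (h0 : ∀ k, ∫ ω, X k ω ∂P = 0) {v : ℕ → ℝ}
    (hv : ∀ k, ∫ ω, X k ω ^ 2 ∂P = v k) (S R : Finset ℕ) :
    ∫ ω, (∏ k ∈ S, X k ω) * (∏ k ∈ R, X k ω) ∂P = if S = R then ∏ k ∈ S, v k else 0 := by
  have hP := hX.isProbabilityMeasure
  -- `g k` is the power of `X k` in the product of the two monomials: the square on `S ∩ R`, the
  -- first power on the symmetric difference.
  let g : ℕ → ℝ → ℝ := fun k x => (if k ∈ S then x else 1) * (if k ∈ R then x else 1)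
  have hg : ∀ k, Measurable (g k) := fun k => by
    dsimp only [g]; split_ifs <;> fun_prop
  have h1 : ∀ ω, (∏ k ∈ S, X k ω) * (∏ k ∈ R, X k ω) =
      ∏ k : ↥(S ∪ R), (g k ∘ X k) ω := by
    intro ω
    rw [Finset.univ_eq_attach, Finset.prod_attach (S ∪ R) (fun k => (g k ∘ X k) ω)]
    simp only [g, Function.comp, Finset.prod_mul_distrib]
    congr 1
    · rw [Finset.prod_ite_mem, Finset.union_inter_cancel_left]
    · rw [Finset.prod_ite_mem, Finset.union_inter_cancel_right]
  have hind : iIndepFun (fun k : ↥(S ∪ R) => g k ∘ X k) P :=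
    (hX.comp g hg).precomp (g := fun k : ↥(S ∪ R) => (k : ℕ)) Subtype.val_injective
  simp_rw [h1]
  rw [hind.integral_fun_prod_eq_prod_integral fun k =>
    ((hg k).comp_aemeasurable (hm k).integrable.aemeasurable).aestronglyMeasurable]
  have h2 : ∀ k, ∫ ω, (g k ∘ X k) ω ∂P =
      if k ∈ S then (if k ∈ R then v k else 0) else (if k ∈ R then 0 else 1) := by
    intro k
    by_cases hS : k ∈ S <;> by_cases hR : k ∈ R <;>
      simp [g, hS, hR, h0, ← hv, pow_two]
  split_ifs with hSR
  · subst hSR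
    rw [Finset.univ_eq_attach, Finset.prod_attach (S ∪ S) (fun k => ∫ ω, (g k ∘ X k) ω ∂P),
      Finset.union_self]
    refine Finset.prod_congr rfl fun k hk => ?_
    rw [h2]; simp [hk]
  -- An index in the symmetric difference contributes the factor `E[X k] = 0`.
  · obtain ⟨k, hk⟩ : ∃ k, ¬ (k ∈ S ↔ k ∈ R) := by
      by_contra h; push Not at h; exact hSR (Finset.ext h)
    have hk' : k ∈ S ∪ R := by
      rw [Finset.mem_union]; tauto
    refine Finset.prod_eq_zero (i := ⟨k, hk'⟩) (Finset.mem_univ _) ?_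
    rw [h2]
    by_cases hS : k ∈ S <;> by_cases hR : k ∈ R <;> simp_all

/-- Disjoint blocks make every monomial of the expanded product square-free, as
`integral_prod_mul_prod` requires. -/
lemma injective_of_mem_piFinset {n : ℕ} {S : Fin n → Finset ℕ}
    (hS : Pairwise fun i j => Disjoint (S i) (S j)) {f : Fin n → ℕ}
    (hf : f ∈ Fintype.piFinset S) : Function.Injective f := by
  intro i j hij
  by_contra hne
  have h := Fintype.mem_piFinset.1 hf
  exact Finset.disjoint_left.1 (hS hne) (h i) (hij ▸ h j)

/-- The covariance of two multilinear forms in independent centred variables, expanded. -/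
lemma integral_prod_sum_mul_prod_sum_aux {X : ℕ → Ω → ℝ} (hX : iIndepFun X P)
    (hm : ∀ k, HasAllMoments P (X k)) (h0 : ∀ k, ∫ ω, X k ω ∂P = 0) {v : ℕ → ℝ}
    (hv : ∀ k, ∫ ω, X k ω ^ 2 ∂P = v k) {n m : ℕ} {S : Fin n → Finset ℕ} {R : Fin m → Finset ℕ}
    (hS : Pairwise fun i j => Disjoint (S i) (S j))
    (hR : Pairwise fun i j => Disjoint (R i) (R j)) :
    ∫ ω, (∏ i, ∑ k ∈ S i, X k ω) * (∏ j, ∑ k ∈ R j, X k ω) ∂P =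
      ∑ f ∈ Fintype.piFinset S, ∑ g ∈ Fintype.piFinset R,
        if Finset.univ.image f = Finset.univ.image g then ∏ i, v (f i) else 0 := by
  have hP := hX.isProbabilityMeasure
  have hp : ∀ {l : ℕ} (f : Fin l → ℕ), HasAllMoments P fun ω => ∏ i, X (f i) ω := fun f =>
    HasAllMoments.prod _ fun i _ => hm (f i)
  simp_rw [Finset.prod_univ_sum, Finset.sum_mul_sum]
  rw [integral_finsetSum _ fun f _ => integrable_finsetSum _ fun g _ =>
    ((hp f).mul (hp g)).integrable]
  refine Finset.sum_congr rfl fun f hf => ?_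
  rw [integral_finsetSum _ fun g _ => ((hp f).mul (hp g)).integrable]
  refine Finset.sum_congr rfl fun g hg => ?_
  have hfi := injective_of_mem_piFinset hS hf
  have hgi := injective_of_mem_piFinset hR hg
  have h := integral_prod_mul_prod hX hm h0 hv (Finset.univ.image f) (Finset.univ.image g)
  simp only [Finset.prod_image hfi.injOn, Finset.prod_image hgi.injOn] at h
  exact h

/-- Square-free monomials of degrees `n ≠ m` cannot use the same set of variables, so no term
survives. -/
lemma integral_prod_sum_mul_prod_sum_of_ne {X : ℕ → Ω → ℝ} (hX : iIndepFun X P)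
    (hm : ∀ k, HasAllMoments P (X k)) (h0 : ∀ k, ∫ ω, X k ω ∂P = 0) {v : ℕ → ℝ}
    (hv : ∀ k, ∫ ω, X k ω ^ 2 ∂P = v k) {n m : ℕ} (hnm : n ≠ m)
    {S : Fin n → Finset ℕ} {R : Fin m → Finset ℕ}
    (hS : Pairwise fun i j => Disjoint (S i) (S j))
    (hR : Pairwise fun i j => Disjoint (R i) (R j)) :
    ∫ ω, (∏ i, ∑ k ∈ S i, X k ω) * (∏ j, ∑ k ∈ R j, X k ω) ∂P = 0 := by
  rw [integral_prod_sum_mul_prod_sum_aux hX hm h0 hv hS hR]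
  refine Finset.sum_eq_zero fun f hf => Finset.sum_eq_zero fun g hg => if_neg fun h => hnm ?_
  have := congrArg Finset.card h
  rwa [Finset.card_image_of_injective _ (injective_of_mem_piFinset hS hf),
    Finset.card_image_of_injective _ (injective_of_mem_piFinset hR hg), Finset.card_fin,
    Finset.card_fin] at this

/-- Injective maps with equal images differ by exactly one permutation. This is the source of the
sum over permutations in the isometry. -/
lemma ite_image_eq_sum_perm {n : ℕ} {f g : Fin n → ℕ} (hf : Function.Injective f)
    (hg : Function.Injective g) (a : ℝ) :
    (if Finset.univ.image f = Finset.univ.image g then a else 0) =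
      ∑ σ : Equiv.Perm (Fin n), if f = g ∘ σ then a else 0 := by
  split_ifs with h
  · have hex : ∀ i, ∃ j, g j = f i := fun i => by
      have : f i ∈ Finset.univ.image g := h ▸ Finset.mem_image_of_mem f (Finset.mem_univ i)
      simpa using this
    choose s hs using hex
    have hsi : Function.Injective s := fun i j hij => hf (by rw [← hs, ← hs, hij])
    let σ : Equiv.Perm (Fin n) := Equiv.ofBijective s (Finite.injective_iff_bijective.1 hsi)
    rw [Finset.sum_eq_single σ]
    · rw [if_pos]
      funext i
      exact (hs i).symm
    · intro τ _ hτ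
      refine if_neg fun hft => hτ ?_
      ext i
      congr 1
      apply hg
      rw [show g (σ i) = f i from hs i, hft]
      rfl
    · simp
  · refine (Finset.sum_eq_zero fun σ _ => if_neg ?_).symm
    rintro rfl
    apply h
    rw [← Finset.image_image, Finset.image_univ_equiv]

/-- The covariance of two multilinear forms of the same degree in independent centred variables. -/
lemma integral_prod_sum_mul_prod_sum {X : ℕ → Ω → ℝ} (hX : iIndepFun X P)
    (hm : ∀ k, HasAllMoments P (X k)) (h0 : ∀ k, ∫ ω, X k ω ∂P = 0) {v : ℕ → ℝ}
    (hv : ∀ k, ∫ ω, X k ω ^ 2 ∂P = v k) {n : ℕ} {S R : Fin n → Finset ℕ}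
    (hS : Pairwise fun i j => Disjoint (S i) (S j))
    (hR : Pairwise fun i j => Disjoint (R i) (R j)) :
    ∫ ω, (∏ i, ∑ k ∈ S i, X k ω) * (∏ j, ∑ k ∈ R j, X k ω) ∂P =
      ∑ σ : Equiv.Perm (Fin n), ∏ i, ∑ k ∈ S (σ i) ∩ R i, v k := by
  rw [integral_prod_sum_mul_prod_sum_aux hX hm h0 hv hS hR]
  have h1 : ∀ f ∈ Fintype.piFinset S, ∀ g ∈ Fintype.piFinset R,
      (if Finset.univ.image f = Finset.univ.image g then ∏ i, v (f i) else 0) =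
        ∑ σ : Equiv.Perm (Fin n), if f = g ∘ σ then ∏ i, v (f i) else 0 := fun f hf g hg =>
    ite_image_eq_sum_perm (injective_of_mem_piFinset hS hf) (injective_of_mem_piFinset hR hg) _
  rw [Finset.sum_congr rfl fun f hf => Finset.sum_congr rfl (h1 f hf)]
  simp_rw [Finset.sum_comm (t := (Finset.univ : Finset (Equiv.Perm (Fin n))))]
  -- After inversion the condition reads `f = g ∘ σ⁻¹`: it eliminates `f` and leaves `g i ∈ S (σ i)
  -- ∩ R i`.
  rw [← Equiv.sum_comp (Equiv.inv (Equiv.Perm (Fin n)))]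
  refine Finset.sum_congr rfl fun σ _ => ?_
  rw [Finset.sum_comm, Finset.prod_univ_sum]
  simp only [Equiv.inv_apply, Finset.sum_ite_eq']
  rw [← Finset.sum_filter]
  refine Finset.sum_congr ?_ fun g _ => ?_
  · ext g
    simp only [Finset.mem_filter, Fintype.mem_piFinset, Finset.mem_inter, Function.comp]
    constructor
    · rintro ⟨h, h'⟩ i
      exact ⟨by simpa using h' (σ i), h i⟩
    · intro h
      exact ⟨fun i => (h i).2, fun i => by simpa using (h (σ⁻¹ i)).1⟩
  · exact Equiv.prod_comp σ⁻¹ fun i => v (g i)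

end Moments

/-! ### Covariances of Brownian increments over boxes -/

section Boxes

variable {Ω : Type*} [MeasurableSpace Ω] {P : Measure Ω} {T : ℝ} {B : Set.Icc (0 : ℝ) T → Ω → ℝ}

/-- The increment product `∏ i, (B (bᵢ) - B (aᵢ))` of a box. -/
def boxIncrement (B : Set.Icc (0 : ℝ) T → Ω → ℝ) {n : ℕ} (b : OffDiagBox T n) (ω : Ω) : ℝ :=
  ∏ i, (B (b.right i) ω - B (b.left i) ω)

lemma IsBrownianMotionOn.hasAllMoments_increment (hB : IsBrownianMotionOn T B P)
    {s t : Set.Icc (0 : ℝ) T} (hst : s ≤ t) : HasAllMoments P fun ω => B t ω - B s ω := by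
  intro p
  have h := hB.gaussian_increments s t hst
  have h2 := memLp_id_gaussianReal (μ := 0) (v := Real.toNNReal ((t : ℝ) - (s : ℝ))) p
  rw [← h.map_eq] at h2
  exact (memLp_map_measure_iff aestronglyMeasurable_id h.aemeasurable).1 h2

lemma IsBrownianMotionOn.integral_increment (hB : IsBrownianMotionOn T B P)
    {s t : Set.Icc (0 : ℝ) T} (hst : s ≤ t) : ∫ ω, (B t ω - B s ω) ∂P = 0 := by
  have h := (hB.gaussian_increments s t hst).integral_comp (f := id) aestronglyMeasurable_id
  simpa using h

lemma IsBrownianMotionOn.integral_increment_sq (hB : IsBrownianMotionOn T B P)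
    {s t : Set.Icc (0 : ℝ) T} (hst : s ≤ t) :
    ∫ ω, (B t ω - B s ω) ^ 2 ∂P = (t : ℝ) - s := by
  have h := (hB.gaussian_increments s t hst).integral_comp (f := fun x : ℝ => x ^ 2)
    (by fun_prop)
  have h2 := variance_of_integral_eq_zero (X := (id : ℝ → ℝ))
    (μ := gaussianReal 0 (Real.toNNReal ((t : ℝ) - (s : ℝ)))) (by fun_prop) (by simp)
  rw [variance_id_gaussianReal, Real.coe_toNNReal _ (sub_nonneg.2 (by exact_mod_cast hst))] at h2
  rw [h2]
  simpa using h

lemma IsBrownianMotionOn.hasAllMoments_boxIncrement [IsFiniteMeasure P]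
    (hB : IsBrownianMotionOn T B P) {n : ℕ} (b : OffDiagBox T n) :
    HasAllMoments P (boxIncrement B b) :=
  HasAllMoments.prod _ fun i _ => hB.hasAllMoments_increment (b.left_le_right i)

/-- Every finite set of times lies on a grid which increases strictly before it becomes constant. -/
lemma exists_grid {α : Type*} [LinearOrder α] (G : Finset α) (hG : G.Nonempty) :
    ∃ (e : ℕ → α) (N : ℕ), Monotone e ∧ StrictMonoOn e (Set.Iic N) ∧
      ∀ x ∈ G, ∃ p, p ≤ N ∧ e p = x := by
  have hc : 0 < G.card := hG.card_pos
  let o := G.orderEmbOfFin rfl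
  -- The grid is continued as a constant to all of `ℕ`, since independence of increments is used
  -- along monotone sequences.
  refine ⟨fun k => o ⟨min k (G.card - 1), by omega⟩, G.card - 1, ?_, ?_, ?_⟩
  · intro a b hab
    apply o.monotone
    simp only [Fin.mk_le_mk]
    omega
  · intro a ha b hb hab
    apply o.strictMono
    simp only [Set.mem_Iic] at ha hb
    simp only [Fin.mk_lt_mk]
    omega
  · intro x hx
    have : x ∈ Set.range o := by
      rw [Finset.range_orderEmbOfFin]; exact hx
    obtain ⟨i, rfl⟩ := this
    refine ⟨i, by omega, ?_⟩
    refine congrArg o (Fin.ext ?_)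
    simp only
    omega

/-- A monotone `e` commutes with `max` and `min`, so intersecting intervals amounts to intersecting
index ranges, over which the lengths telescope. -/
lemma volume_real_Ioc_inter_Ioc {e : ℕ → Set.Icc (0 : ℝ) T} (he : Monotone e) (p q p' q' : ℕ) :
    volume.real (Set.Ioc (e p : ℝ) (e q) ∩ Set.Ioc (e p' : ℝ) (e q')) =
      ∑ k ∈ Finset.Ico p q ∩ Finset.Ico p' q', ((e (k + 1) : ℝ) - e k) := by
  have hm : Monotone fun k => (e k : ℝ) := fun a b h => he h
  have h1 := hm.map_max (a := p) (b := p')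
  have h2 := hm.map_min (a := q) (b := q')
  rw [Set.Ioc_inter_Ioc, Finset.Ico_inter_Ico, Real.volume_real_Ioc, ← h1, ← h2]
  rcases le_total (max p p') (min q q') with h | h
  · rw [Finset.sum_Ico_sub (fun k => (e k : ℝ)) h, max_eq_left (sub_nonneg.2 (hm h))]
  · rw [Finset.Ico_eq_empty_of_le h, Finset.sum_empty, max_eq_right (sub_nonpos.2 (hm h))]

lemma exists_boxGrid {n : ℕ} (b : OffDiagBox T n) {e : ℕ → Set.Icc (0 : ℝ) T} {N : ℕ}
    (hs : StrictMonoOn e (Set.Iic N))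
    (hl : ∀ i, ∃ p, p ≤ N ∧ e p = b.left i) (hr : ∀ i, ∃ p, p ≤ N ∧ e p = b.right i) :
    ∃ p q : Fin n → ℕ, (∀ i, e (p i) = b.left i) ∧ (∀ i, e (q i) = b.right i) ∧
      (∀ i, p i ≤ q i) ∧
      Pairwise fun i j => Disjoint (Finset.Ico (p i) (q i)) (Finset.Ico (p j) (q j)) := by
  choose p hpN hp using hl
  choose q hqN hq using hr
  refine ⟨p, q, hp, hq, fun i => ?_, fun i j hij => ?_⟩
  · have := b.left_le_right i
    rw [← hp, ← hq] at this
    exact (hs.le_iff_le (hpN i) (hqN i)).1 this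
  · refine Finset.disjoint_left.2 fun k hk hk' => ?_
    rw [Finset.mem_Ico] at hk hk'
    -- A common index `k` would put `e (k + 1)` into two disjoint sides. Strictness of the grid is
    -- essential, because the sides exclude their left ends.
    have key : ∀ i, p i ≤ k → k < q i →
        (e (k + 1) : ℝ) ∈ Set.Ioc (b.left i : ℝ) (b.right i : ℝ) := by
      intro i h1 h2
      have hN := hqN i
      rw [← hp, ← hq]
      constructor
      · exact_mod_cast hs (hpN i) (show k + 1 ≤ N by omega) (by omega)
      · exact_mod_cast hs.monotoneOn (show k + 1 ≤ N by omega) (hqN i) (by omega)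
    exact Set.disjoint_left.1 (b.disjoint_sides hij) (key i hk.1 hk.2) (key j hk'.1 hk'.2)

lemma exists_common_grid {n m : ℕ} (b : OffDiagBox T n) (c : OffDiagBox T m) (h : 0 < n + m) :
    ∃ (e : ℕ → Set.Icc (0 : ℝ) T) (N : ℕ), Monotone e ∧ StrictMonoOn e (Set.Iic N) ∧
      (∀ i, ∃ p, p ≤ N ∧ e p = b.left i) ∧ (∀ i, ∃ p, p ≤ N ∧ e p = b.right i) ∧
      (∀ i, ∃ p, p ≤ N ∧ e p = c.left i) ∧ (∀ i, ∃ p, p ≤ N ∧ e p = c.right i) := by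
  classical
  let G : Finset (Set.Icc (0 : ℝ) T) := Finset.univ.image b.left ∪ Finset.univ.image b.right ∪
    (Finset.univ.image c.left ∪ Finset.univ.image c.right)
  have hG : G.Nonempty := by
    rcases Nat.eq_zero_or_pos n with hn | hn
    · exact ⟨c.left ⟨0, by omega⟩, by simp [G]⟩
    · exact ⟨b.left ⟨0, by omega⟩, by simp [G]⟩
  obtain ⟨e, N, he, hs, hx⟩ := exists_grid G hG
  exact ⟨e, N, he, hs, fun i => hx _ (by simp [G]), fun i => hx _ (by simp [G]),
    fun i => hx _ (by simp [G]), fun i => hx _ (by simp [G])⟩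

/-- Increments over boxes of different orders are orthogonal. -/
lemma IsBrownianMotionOn.integral_boxIncrement_mul_of_ne (hB : IsBrownianMotionOn T B P)
    {n m : ℕ} (hnm : n ≠ m) (b : OffDiagBox T n) (c : OffDiagBox T m) :
    ∫ ω, boxIncrement B b ω * boxIncrement B c ω ∂P = 0 := by
  obtain ⟨e, N, he, hs, h1, h2, h3, h4⟩ := exists_common_grid b c (by omega)
  obtain ⟨p, q, hp, hq, hpq, hd⟩ := exists_boxGrid b hs h1 h2
  obtain ⟨p', q', hp', hq', hpq', hd'⟩ := exists_boxGrid c hs h3 h4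
  have h := integral_prod_sum_mul_prod_sum_of_ne (hB.indep_increments.nat he)
    (fun k => hB.hasAllMoments_increment (he k.le_succ))
    (fun k => hB.integral_increment (he k.le_succ))
    (fun k => hB.integral_increment_sq (he k.le_succ)) hnm hd hd'
  rw [← h]
  congr 1 with ω
  simp only [boxIncrement, ← hp, ← hq, ← hp', ← hq']
  congr 1 <;> refine Finset.prod_congr rfl fun i _ => ?_
  · exact (Finset.sum_Ico_sub (fun k => B (e k) ω) (hpq i)).symm
  · exact (Finset.sum_Ico_sub (fun k => B (e k) ω) (hpq' i)).symm

/-- The covariance of the increments over two boxes of the same order. -/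
lemma IsBrownianMotionOn.integral_boxIncrement_mul [IsProbabilityMeasure P]
    (hB : IsBrownianMotionOn T B P) {n : ℕ} (b c : OffDiagBox T n) :
    ∫ ω, boxIncrement B b ω * boxIncrement B c ω ∂P =
      ∑ σ : Equiv.Perm (Fin n), ∏ i, volume.real
        (Set.Ioc (b.left (σ i) : ℝ) (b.right (σ i)) ∩ Set.Ioc (c.left i : ℝ) (c.right i)) := by
  rcases Nat.eq_zero_or_pos n with rfl | hn
  · simp [boxIncrement]
  obtain ⟨e, N, he, hs, h1, h2, h3, h4⟩ := exists_common_grid b c (by omega)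
  obtain ⟨p, q, hp, hq, hpq, hd⟩ := exists_boxGrid b hs h1 h2
  obtain ⟨p', q', hp', hq', hpq', hd'⟩ := exists_boxGrid c hs h3 h4
  have h := integral_prod_sum_mul_prod_sum (hB.indep_increments.nat he)
    (fun k => hB.hasAllMoments_increment (he k.le_succ))
    (fun k => hB.integral_increment (he k.le_succ))
    (fun k => hB.integral_increment_sq (he k.le_succ)) hd hd'
  simp only [← hp, ← hq, ← hp', ← hq', volume_real_Ioc_inter_Ioc he]
  rw [← h]
  congr 1 with ω
  simp only [boxIncrement, ← hp, ← hq, ← hp', ← hq']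
  congr 1 <;> refine Finset.prod_congr rfl fun i _ => ?_
  · exact (Finset.sum_Ico_sub (fun k => B (e k) ω) (hpq i)).symm
  · exact (Finset.sum_Ico_sub (fun k => B (e k) ω) (hpq' i)).symm

end Boxes

/-! ### Permutations of variables and density of elementary functions -/

section Cube

variable {T : ℝ}

lemma measurePreserving_comp_perm (T : ℝ) {n : ℕ} (σ : Equiv.Perm (Fin n)) :
    MeasurePreserving (fun t : Fin n → ℝ => t ∘ σ) (cube T n) (cube T n) :=
  measurePreserving_arrowCongr' (fun _ => (volume : Measure ℝ).restrict (Set.Icc 0 T))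
    (fun _ => (volume : Measure ℝ).restrict (Set.Icc 0 T)) σ.symm (MeasurableEquiv.refl ℝ)
    fun _ => MeasurePreserving.id _

/-- The action of a permutation of the variables on `L²([0, T]^n)`. -/
noncomputable def permute (T : ℝ) {n : ℕ} (σ : Equiv.Perm (Fin n)) :
    Lp ℝ 2 (cube T n) →ₗᵢ[ℝ] Lp ℝ 2 (cube T n) :=
  Lp.compMeasurePreservingₗᵢ ℝ (fun t : Fin n → ℝ => t ∘ σ) (measurePreserving_comp_perm T σ)

lemma coeFn_permute {n : ℕ} (σ : Equiv.Perm (Fin n)) (h : Lp ℝ 2 (cube T n)) :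
    permute T σ h =ᵐ[cube T n] fun t => h (t ∘ σ) :=
  Lp.coeFn_compMeasurePreserving h (measurePreserving_comp_perm T σ)

lemma IsSymmetric.permute_eq {n : ℕ} {h : Lp ℝ 2 (cube T n)} (hh : IsSymmetric h)
    (σ : Equiv.Perm (Fin n)) : permute T σ h = h :=
  Lp.ext ((coeFn_permute σ h).trans (hh σ))

lemma isSymmetric_iff {n : ℕ} {h : Lp ℝ 2 (cube T n)} :
    IsSymmetric h ↔ ∀ σ, permute T σ h = h := by
  refine ⟨fun hh => hh.permute_eq, fun hh σ => (coeFn_permute σ h).symm.trans ?_⟩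
  rw [hh σ]

lemma elementaryFunction_single {n : ℕ} (b : OffDiagBox T n) (a : ℝ) :
    elementaryFunction T n (Finsupp.single b a) = a • indicatorConstLp 2 b.measurableSet_toSet
      (measure_ne_top (cube T n) b.toSet) (1 : ℝ) := by
  simp [elementaryFunction]

lemma cube_real_pi {n : ℕ} (s : Fin n → Set ℝ) (hs : ∀ i, MeasurableSet (s i))
    (hsub : ∀ i, s i ⊆ Set.Icc 0 T) :
    (cube T n).real (Set.univ.pi s) = ∏ i, volume.real (s i) := by
  simp only [Measure.real, cube, Measure.pi_pi, ENNReal.toReal_prod]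
  refine Finset.prod_congr rfl fun i _ => ?_
  rw [Measure.restrict_apply (hs i), Set.inter_eq_self_of_subset_left (hsub i)]

/-- The inner product of an off-diagonal box with a permuted off-diagonal box. -/
lemma inner_indicator_permute_indicator {n : ℕ} (b c : OffDiagBox T n)
    (σ : Equiv.Perm (Fin n)) :
    inner ℝ (indicatorConstLp 2 b.measurableSet_toSet (measure_ne_top (cube T n) b.toSet) (1 : ℝ))
      (permute T σ (indicatorConstLp 2 c.measurableSet_toSet
        (measure_ne_top (cube T n) c.toSet) (1 : ℝ))) =
      ∏ i, volume.real
        (Set.Ioc (b.left (σ i) : ℝ) (b.right (σ i)) ∩ Set.Ioc (c.left i : ℝ) (c.right i)) := by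
  have hmp := measurePreserving_comp_perm T σ
  rw [L2.inner_indicatorConstLp_one]
  have h1 : permute T σ (indicatorConstLp 2 c.measurableSet_toSet
        (measure_ne_top (cube T n) c.toSet) (1 : ℝ)) =ᵐ[cube T n]
      ((fun t : Fin n → ℝ => t ∘ σ) ⁻¹' c.toSet).indicator fun _ => 1 := by
    refine (coeFn_permute σ _).trans ?_
    exact hmp.quasiMeasurePreserving.ae_eq_comp indicatorConstLp_coeFn
  have hmeas : MeasurableSet ((fun t : Fin n → ℝ => t ∘ σ) ⁻¹' c.toSet) :=
    hmp.measurable c.measurableSet_toSet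
  rw [setIntegral_congr_ae b.measurableSet_toSet (h1.mono fun x hx _ => hx),
    setIntegral_indicator hmeas, setIntegral_const, smul_eq_mul, mul_one,
    ← cube_real_pi (T := T) _ (fun i => measurableSet_Ioc.inter measurableSet_Ioc)
      (fun i => Set.inter_subset_right.trans (Set.Ioc_subset_Icc_self.trans
        (Set.Icc_subset_Icc (c.left i).2.1 (c.right i).2.2)))]
  rw [← hmp.measureReal_preimage (MeasurableSet.univ_pi fun i =>
    measurableSet_Ioc.inter measurableSet_Ioc).nullMeasurableSet]
  congr 1
  ext t
  simp only [OffDiagBox.toSet, Set.mem_inter_iff, Set.mem_pi, Set.mem_univ, true_imp_iff,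
    Set.mem_preimage, Function.comp]
  constructor
  · rintro ⟨h, h'⟩ i
    exact ⟨h _, h' i⟩
  · intro h
    exact ⟨fun i => by simpa using (h (σ.symm i)).1, fun i => (h i).2⟩

/-- The points on the diagonals form a null set. -/
lemma ae_injective_cube (T : ℝ) (n : ℕ) : ∀ᵐ t ∂(cube T n), Function.Injective t := by
  have hac : cube T n ≪ (volume : Measure (Fin n → ℝ)) := by
    rw [cube, ← Measure.restrict_pi_pi, ← volume_pi]
    exact Measure.absolutelyContinuous_of_le Measure.restrict_le_self
  refine hac.ae_le ?_
  have h : ∀ i j : Fin n, i ≠ j → ∀ᵐ t : Fin n → ℝ, t i ≠ t j := by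
    intro i j hij
    let V : Submodule ℝ (Fin n → ℝ) :=
      LinearMap.ker ((LinearMap.proj i : (Fin n → ℝ) →ₗ[ℝ] ℝ) - LinearMap.proj j)
    have hV : V ≠ ⊤ := by
      intro h
      have h1 : (Pi.single i 1 : Fin n → ℝ) ∈ V := h ▸ Submodule.mem_top
      simp [V, hij] at h1
    have h0 := Measure.addHaar_submodule (volume : Measure (Fin n → ℝ)) V hV
    rw [ae_iff]
    convert h0 using 2
    ext t
    simp [V, sub_eq_zero]
  have h' : ∀ᵐ t : Fin n → ℝ, ∀ i j, i ≠ j → t i ≠ t j := by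
    simp only [ae_all_iff]
    exact h
  filter_upwards [h'] with t ht i j hij
  by_contra hne
  exact ht i j hne hij

lemma ae_mem_Ioo_cube (T : ℝ) (n : ℕ) : ∀ᵐ t ∂(cube T n), ∀ i, t i ∈ Set.Ioo 0 T := by
  rw [ae_all_iff]
  intro i
  have h : ∀ᵐ x ∂((volume : Measure ℝ).restrict (Set.Icc 0 T)), x ∈ Set.Ioo 0 T := by
    rw [restrict_Ioo_eq_restrict_Icc.symm]
    exact ae_restrict_mem measurableSet_Ioo
  exact (Measure.quasiMeasurePreserving_eval
    (μ := fun _ : Fin n => (volume : Measure ℝ).restrict (Set.Icc 0 T)) i).ae h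

/-- The box with its sides cut off at `c`. -/
def OffDiagBox.cut {n : ℕ} (b : OffDiagBox T n) (c : Fin n → ℝ) : OffDiagBox T n where
  left := b.left
  -- The maximum makes a side empty, `(a, a]`, when the cut lies below its left end.
  right i := ⟨max (b.left i) (min (b.right i) (c i)), (b.left i).2.1.trans (le_max_left _ _),
    max_le (b.left i).2.2 ((min_le_left _ _).trans (b.right i).2.2)⟩
  left_le_right _ := Subtype.coe_le_coe.1 (le_max_left _ _)
  disjoint_sides i j hij := (b.disjoint_sides hij).mono
    (Set.Ioc_subset_Ioc_right (max_le (b.left_le_right i) (min_le_left _ _)))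
    (Set.Ioc_subset_Ioc_right (max_le (b.left_le_right j) (min_le_left _ _)))

lemma OffDiagBox.toSet_cut {n : ℕ} (b : OffDiagBox T n) (c : Fin n → ℝ) :
    (b.cut c).toSet = b.toSet ∩ Set.univ.pi fun i => Set.Iic (c i) := by
  rw [OffDiagBox.toSet, OffDiagBox.toSet, ← Set.pi_inter_distrib]
  refine Set.pi_congr rfl fun i _ => ?_
  ext x
  simp only [OffDiagBox.cut, Set.mem_Ioc, Set.mem_inter_iff, Set.mem_Iic, le_max_iff, le_min_iff]
  constructor
  · rintro ⟨h1, h2⟩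
    exact ⟨⟨h1, (h2.resolve_left (not_le.2 h1)).1⟩, (h2.resolve_left (not_le.2 h1)).2⟩
  · rintro ⟨⟨h1, h2⟩, h3⟩
    exact ⟨h1, Or.inr ⟨h2, h3⟩⟩

/-- An integrable function all of whose integrals over off-diagonal boxes vanish is zero almost
everywhere on each such box. -/
lemma ae_restrict_eq_zero_of_box {n : ℕ} {f : (Fin n → ℝ) → ℝ} (hf : Integrable f (cube T n))
    (h : ∀ b : OffDiagBox T n, ∫ t in b.toSet, f t ∂(cube T n) = 0) (b : OffDiagBox T n) :
    f =ᵐ[(cube T n).restrict b.toSet] 0 := by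
  set μ := (cube T n).restrict b.toSet with hμ
  have hfb : Integrable f μ := hf.restrict
  have hgen : (MeasurableSpace.pi : MeasurableSpace (Fin n → ℝ)) =
      MeasurableSpace.generateFrom (Set.univ.pi '' Set.univ.pi fun _ : Fin n =>
        (Set.range Set.Iic : Set (Set ℝ))) := by
    rw [← generateFrom_pi_eq]
    · congr
      funext i
      rw [← borel_eq_generateFrom_Iic]
      exact BorelSpace.measurable_eq
    · intro i
      refine ⟨fun k => Set.Iic (k : ℝ), fun k => ⟨_, rfl⟩, ?_⟩
      ext x
      simpa using exists_nat_ge x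
  -- A π-λ argument: orthants form a generating π-system, and an orthant meets `b` in a cut of `b`,
  -- which is again an off-diagonal box.
  refine hfb.ae_eq_zero_of_forall_setIntegral_eq_zero fun s hs _ => ?_
  induction s, hs using MeasurableSpace.induction_on_inter hgen
    (IsPiSystem.pi fun _ => isPiSystem_Iic) with
  | empty => simp
  | basic t ht =>
    obtain ⟨u, hu, rfl⟩ := ht
    choose c hc using fun i => hu i (Set.mem_univ i)
    obtain rfl : (fun i => Set.Iic (c i)) = u := funext hc
    rw [Measure.restrict_restrict (MeasurableSet.univ_pi fun i => measurableSet_Iic),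
      Set.inter_comm, ← b.toSet_cut c]
    exact h _
  | compl t ht iht =>
    have h1 := integral_add_compl ht hfb
    rw [iht (measure_lt_top μ t), zero_add] at h1
    rw [h1]
    exact h b
  | iUnion g hd hm ihg =>
    rw [integral_iUnion hm hd hfb.integrableOn]
    simp [ihg]

lemma exists_offDiagBox_mem_nhds {n : ℕ} {t : Fin n → ℝ} (hi : Function.Injective t)
    (ht : ∀ i, t i ∈ Set.Ioo 0 T) : ∃ b : OffDiagBox T n, b.toSet ∈ nhds t := by
  have hδ : ∃ δ > 0, ∀ i j, i ≠ j → 2 * δ ≤ |t i - t j| := by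
    -- The extra element `1` keeps the minimum defined when there are no pairs, that is for `n ≤ 1`.
    let s : Finset ℝ := insert 1 ((Finset.univ.filter fun x : Fin n × Fin n => x.1 ≠ x.2).image
      fun x => |t x.1 - t x.2|)
    have hs : s.Nonempty := ⟨1, Finset.mem_insert_self _ _⟩
    refine ⟨s.min' hs / 2, half_pos ((Finset.lt_min'_iff _ _).2 fun y hy => ?_), fun i j hij => ?_⟩
    · rcases Finset.mem_insert.1 hy with rfl | hy
      · exact one_pos
      · obtain ⟨x, hx, rfl⟩ := Finset.mem_image.1 hy
        exact abs_pos.2 (sub_ne_zero.2 fun h => (Finset.mem_filter.1 hx).2 (hi h))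
    · rw [mul_div_cancel₀ _ two_ne_zero]
      refine Finset.min'_le _ _ (Finset.mem_insert_of_mem (Finset.mem_image.2 ⟨(i, j), ?_, rfl⟩))
      simpa using hij
  obtain ⟨δ, hδ, hsep⟩ := hδ
  let b : OffDiagBox T n :=
    { left := fun i => ⟨max 0 (t i - δ), le_max_left _ _,
        max_le ((ht i).1.trans (ht i).2).le (by linarith [(ht i).2])⟩
      right := fun i => ⟨min T (t i + δ), le_min ((ht i).1.trans (ht i).2).le
        (by linarith [(ht i).1]), min_le_left _ _⟩
      left_le_right := fun i => Subtype.coe_le_coe.1 (le_min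
        (max_le ((ht i).1.trans (ht i).2).le (by linarith [(ht i).2]))
        (max_le (by linarith [(ht i).1]) (by linarith)))
      disjoint_sides := fun i j hij => by
        refine Set.disjoint_left.2 fun x hx hx' => ?_
        simp only [Set.mem_Ioc, max_lt_iff, le_min_iff] at hx hx'
        have := hsep i j hij
        rcases le_abs'.1 this with h | h <;> linarith [hx.1.2, hx.2.2, hx'.1.2, hx'.2.2] }
  refine ⟨b, set_pi_mem_nhds Set.finite_univ fun i _ => ?_⟩
  refine Filter.mem_of_superset (Ioo_mem_nhds ?_ ?_) Set.Ioo_subset_Ioc_self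
  · exact max_lt (ht i).1 (by linarith)
  · exact lt_min (ht i).2 (by linarith)

/-- Almost every point is interior and off the diagonals, so it has a box as neighbourhood; a
locally null set is null. -/
lemma ae_eq_zero_of_box {n : ℕ} {f : (Fin n → ℝ) → ℝ} (hf : Integrable f (cube T n))
    (h : ∀ b : OffDiagBox T n, ∫ t in b.toSet, f t ∂(cube T n) = 0) : f =ᵐ[cube T n] 0 := by
  have hnull : cube T n
      ({t | Function.Injective t ∧ ∀ i, t i ∈ Set.Ioo 0 T} ∩ {t | f t ≠ 0}) = 0 := by
    refine measure_null_of_locally_null _ fun t ht => ?_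
    obtain ⟨b, hb⟩ := exists_offDiagBox_mem_nhds ht.1.1 ht.1.2
    refine ⟨_, inter_mem_nhdsWithin _ hb, ?_⟩
    have h0 := ae_restrict_eq_zero_of_box hf h b
    have h1 := (ae_restrict_iff' b.measurableSet_toSet).1 h0
    refine measure_mono_null ?_ (ae_iff.1 h1)
    rintro x ⟨⟨-, hx⟩, hxb⟩ hx'
    exact hx (hx' hxb)
  have h2 : ∀ᵐ t ∂(cube T n), ¬ ((Function.Injective t ∧ ∀ i, t i ∈ Set.Ioo 0 T) ∧ f t ≠ 0) := by
    rw [ae_iff]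
    simp only [not_not]
    exact hnull
  filter_upwards [h2, ae_injective_cube T n, ae_mem_Ioo_cube T n] with t h1 h3 h4
  by_contra hne
  exact h1 ⟨⟨h3, h4⟩, hne⟩

/-- The elementary functions are dense in `L²([0, T]^n)`. -/
lemma denseRange_elementaryFunction (T : ℝ) (n : ℕ) : DenseRange (elementaryFunction T n) := by
  have h : (LinearMap.range (elementaryFunction T n)).topologicalClosure = ⊤ := by
    rw [Submodule.topologicalClosure_eq_top_iff, Submodule.eq_bot_iff]
    intro f hf
    refine Lp.ext ((ae_eq_zero_of_box ?_ fun b => ?_).trans (Lp.coeFn_zero ℝ 2 (cube T n)).symm)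
    · exact (Lp.memLp f).integrable one_le_two
    · have h1 := (Submodule.mem_orthogonal _ _).1 hf (elementaryFunction T n (Finsupp.single b 1))
        (LinearMap.mem_range_self _ _)
      rwa [elementaryFunction_single, one_smul, L2.inner_indicatorConstLp_one] at h1
  have h2 := (Submodule.dense_iff_topologicalClosure_eq_top).2 h
  exact h2

end Cube

/-! ### The Itô isometry -/

section Isometry

variable {Ω : Type*} [MeasurableSpace Ω] {P : Measure Ω} {T : ℝ} {B : Set.Icc (0 : ℝ) T → Ω → ℝ}

lemma elementaryIntegral_single {n : ℕ} (b : OffDiagBox T n) (a : ℝ) :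
    elementaryIntegral B P n (Finsupp.single b a) = a • toL2 P (boxIncrement B b) := by
  simp only [elementaryIntegral, Finsupp.linearCombination_single]
  rfl

lemma inner_toL2 {α : Type*} [MeasurableSpace α] {μ : Measure α} {f g : α → ℝ} (hf : MemLp f 2 μ)
    (hg : MemLp g 2 μ) : inner ℝ (toL2 μ f) (toL2 μ g) = ∫ x, f x * g x ∂μ := by
  rw [toL2, dif_pos hf, toL2, dif_pos hg, L2.inner_def]
  refine integral_congr_ae ?_
  filter_upwards [hf.coeFn_toLp, hg.coeFn_toLp] with x h1 h2
  simp [h1, h2, mul_comm]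

lemma IsBrownianMotionOn.inner_elementaryIntegral_of_ne [IsProbabilityMeasure P]
    (hB : IsBrownianMotionOn T B P) {n m : ℕ} (hnm : n ≠ m) (x : OffDiagBox T n →₀ ℝ)
    (y : OffDiagBox T m →₀ ℝ) :
    inner ℝ (elementaryIntegral B P n x) (elementaryIntegral B P m y) = 0 := by
  induction x using Finsupp.induction_linear with
  | zero => simp
  | add x x' hx hx' => rw [map_add, inner_add_left, hx, hx', add_zero]
  | single b a =>
    induction y using Finsupp.induction_linear with
    | zero => simp
    | add y y' hy hy' => rw [map_add, inner_add_right, hy, hy', add_zero]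
    | single c d =>
      rw [elementaryIntegral_single, elementaryIntegral_single, inner_smul_left, inner_smul_right,
        inner_toL2 (hB.hasAllMoments_boxIncrement b).memLp_two
          (hB.hasAllMoments_boxIncrement c).memLp_two,
        hB.integral_boxIncrement_mul_of_ne hnm, mul_zero, mul_zero]

lemma IsBrownianMotionOn.inner_elementaryIntegral [IsProbabilityMeasure P]
    (hB : IsBrownianMotionOn T B P) {n : ℕ} (x y : OffDiagBox T n →₀ ℝ) :
    inner ℝ (elementaryIntegral B P n x) (elementaryIntegral B P n y) =
      ∑ σ : Equiv.Perm (Fin n),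
        inner ℝ (elementaryFunction T n x) (permute T σ (elementaryFunction T n y)) := by
  induction x using Finsupp.induction_linear with
  | zero => simp
  | add x x' hx hx' =>
    simp only [map_add, inner_add_left, hx, hx', Finset.sum_add_distrib]
  | single b a =>
    induction y using Finsupp.induction_linear with
    | zero => simp
    | add y y' hy hy' =>
      simp only [map_add, inner_add_right, hy, hy', Finset.sum_add_distrib]
    | single c d =>
      simp only [elementaryIntegral_single, elementaryFunction_single, map_smul, inner_smul_left,
        inner_smul_right, inner_indicator_permute_indicator, ← Finset.mul_sum]
      rw [inner_toL2 (hB.hasAllMoments_boxIncrement b).memLp_two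
          (hB.hasAllMoments_boxIncrement c).memLp_two, hB.integral_boxIncrement_mul]

/-- Each of the `n!` permutations acts isometrically, so Cauchy–Schwarz bounds every term by the
squared norm. This bound makes the extension by continuity agree with the elementary integral. -/
lemma IsBrownianMotionOn.norm_elementaryIntegral_le [IsProbabilityMeasure P]
    (hB : IsBrownianMotionOn T B P) {n : ℕ} (x : OffDiagBox T n →₀ ℝ) :
    ‖elementaryIntegral B P n x‖ ≤ Real.sqrt n.factorial * ‖elementaryFunction T n x‖ := by
  refine le_of_sq_le_sq ?_ (by positivity)
  rw [mul_pow, Real.sq_sqrt (by positivity), ← real_inner_self_eq_norm_sq,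
    hB.inner_elementaryIntegral]
  calc _ ≤ ∑ _σ : Equiv.Perm (Fin n), ‖elementaryFunction T n x‖ ^ 2 := by
        refine Finset.sum_le_sum fun σ _ => (real_inner_le_norm _ _).trans_eq ?_
        rw [LinearIsometry.norm_map, pow_two]
    _ = _ := by simp [Fintype.card_perm]

lemma IsBrownianMotionOn.multipleIntegral_elementaryFunction [IsProbabilityMeasure P]
    (hB : IsBrownianMotionOn T B P) {n : ℕ} (x : OffDiagBox T n →₀ ℝ) :
    multipleIntegral B P n (elementaryFunction T n x) = elementaryIntegral B P n x :=
  LinearMap.extendOfNorm_eq (denseRange_elementaryFunction T n)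
    ⟨_, hB.norm_elementaryIntegral_le⟩ x

/-- Multiple integrals of different orders are orthogonal. -/
lemma IsBrownianMotionOn.inner_multipleIntegral_of_ne [IsProbabilityMeasure P]
    (hB : IsBrownianMotionOn T B P) {n m : ℕ} (hnm : n ≠ m) (f : Lp ℝ 2 (cube T n))
    (g : Lp ℝ 2 (cube T m)) :
    inner ℝ (multipleIntegral B P n f) (multipleIntegral B P m g) = 0 := by
  induction f using (denseRange_elementaryFunction T n).induction_on with
  | hp => exact isClosed_eq (by fun_prop) continuous_const
  | ih x =>
    induction g using (denseRange_elementaryFunction T m).induction_on with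
    | hp => exact isClosed_eq (by fun_prop) continuous_const
    | ih y =>
      rw [hB.multipleIntegral_elementaryFunction, hB.multipleIntegral_elementaryFunction]
      exact hB.inner_elementaryIntegral_of_ne hnm x y

/-- The Itô isometry for multiple integrals of the same order. -/
lemma IsBrownianMotionOn.inner_multipleIntegral [IsProbabilityMeasure P]
    (hB : IsBrownianMotionOn T B P) {n : ℕ} (f g : Lp ℝ 2 (cube T n)) :
    inner ℝ (multipleIntegral B P n f) (multipleIntegral B P n g) =
      ∑ σ : Equiv.Perm (Fin n), inner ℝ f (permute T σ g) := by
  have hc : ∀ σ : Equiv.Perm (Fin n), Continuous (permute T σ) := fun σ =>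
    (permute T σ).continuous
  induction f using (denseRange_elementaryFunction T n).induction_on with
  | hp => exact isClosed_eq (by fun_prop) (by fun_prop)
  | ih x =>
    induction g using (denseRange_elementaryFunction T n).induction_on with
    | hp => exact isClosed_eq (by fun_prop) (by fun_prop)
    | ih y =>
      rw [hB.multipleIntegral_elementaryFunction, hB.multipleIntegral_elementaryFunction]
      exact hB.inner_elementaryIntegral x y

lemma IsBrownianMotionOn.norm_multipleIntegral_sq [IsProbabilityMeasure P]
    (hB : IsBrownianMotionOn T B P) {n : ℕ} {h : Lp ℝ 2 (cube T n)} (hh : IsSymmetric h) :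
    ‖multipleIntegral B P n h‖ ^ 2 = n.factorial * ‖h‖ ^ 2 := by
  rw [← real_inner_self_eq_norm_sq, hB.inner_multipleIntegral]
  simp [hh.permute_eq, Fintype.card_perm]

end Isometry

/-! ### Orthogonal series in a Hilbert space -/

section OrthogonalSeries

variable {E : Type*} [NormedAddCommGroup E] [InnerProductSpace ℝ E]

/-- Using spanned lines instead of normalized vectors allows zero terms. -/
lemma orthogonalFamily_span {f : ℕ → E} (hf : ∀ i j, i ≠ j → inner ℝ (f i) (f j) = 0) :
    OrthogonalFamily ℝ (fun i => ↥(ℝ ∙ f i)) fun i => (ℝ ∙ f i).subtypeₗᵢ := by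
  refine OrthogonalFamily.of_pairwise fun i j hij => ?_
  change (ℝ ∙ f i) ⟂ (ℝ ∙ f j)
  rw [Submodule.isOrtho_span]
  rintro u rfl v rfl
  exact hf i j hij

lemma summable_iff_of_orthogonal [CompleteSpace E] {f : ℕ → E}
    (hf : ∀ i j, i ≠ j → inner ℝ (f i) (f j) = 0) :
    Summable f ↔ Summable fun i => ‖f i‖ ^ 2 :=
  (orthogonalFamily_span hf).summable_iff_norm_sq_summable
    fun i => ⟨f i, Submodule.mem_span_singleton_self _⟩

lemma norm_tsum_sq_of_orthogonal [CompleteSpace E] {f : ℕ → E}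
    (hf : ∀ i j, i ≠ j → inner ℝ (f i) (f j) = 0) (hs : Summable f) :
    HasSum (fun i => ‖f i‖ ^ 2) (‖∑' i, f i‖ ^ 2) := by
  have h1 : Filter.Tendsto (fun s : Finset ℕ => ‖∑ i ∈ s, f i‖ ^ 2) Filter.atTop
      (nhds (‖∑' i, f i‖ ^ 2)) := (hs.hasSum.norm).pow 2
  have h2 := (orthogonalFamily_span hf).norm_sum
    fun i => ⟨f i, Submodule.mem_span_singleton_self _⟩
  refine h1.congr fun s => ?_
  simpa using h2 s

end OrthogonalSeries

/-! ### Uniqueness of kernels and the norm of `𝒢_λ` -/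

section Chaos

variable {Ω : Type*} [MeasurableSpace Ω] {P : Measure Ω} {T : ℝ} {B : Set.Icc (0 : ℝ) T → Ω → ℝ}

/-- Orthogonality of orders leaves only the `n`-th term, so `X` alone determines its pairings with
the `n`-th chaos. -/
lemma IsChaosExpansion.inner_multipleIntegral [IsProbabilityMeasure P]
    (hB : IsBrownianMotionOn T B P) {X : Lp ℝ 2 P} {h : ∀ n, Lp ℝ 2 (cube T n)}
    (hX : IsChaosExpansion B P X h) (n : ℕ) (g : Lp ℝ 2 (cube T n)) :
    inner ℝ X (multipleIntegral B P n g) =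
      inner ℝ (multipleIntegral B P n (h n)) (multipleIntegral B P n g) := by
  have h1 : HasSum (fun m => inner ℝ (multipleIntegral B P m (h m)) (multipleIntegral B P n g))
      (inner ℝ X (multipleIntegral B P n g)) := by
    have := hX.2.mapL (innerSL ℝ (multipleIntegral B P n g))
    simpa only [innerSL_apply_apply, real_inner_comm] using this
  exact h1.unique (hasSum_single n fun m hm => hB.inner_multipleIntegral_of_ne hm _ _)

/-- The kernels of a chaos expansion are unique. -/
lemma IsChaosExpansion.unique [IsProbabilityMeasure P]
    (hB : IsBrownianMotionOn T B P) {X : Lp ℝ 2 P} {h h' : ∀ n, Lp ℝ 2 (cube T n)}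
    (hX : IsChaosExpansion B P X h) (hX' : IsChaosExpansion B P X h') : h = h' := by
  funext n
  -- The norm of a multiple integral controls its kernel only when the kernel is symmetric.
  have hs : IsSymmetric (h n - h' n) := isSymmetric_iff.2 fun σ => by
    rw [map_sub, (hX.1 n).permute_eq, (hX'.1 n).permute_eq]
  have h0 : ‖multipleIntegral B P n (h n - h' n)‖ ^ 2 = 0 := by
    rw [← real_inner_self_eq_norm_sq]
    nth_rw 1 [map_sub]
    rw [inner_sub_left, ← hX.inner_multipleIntegral hB, ← hX'.inner_multipleIntegral hB, sub_self]
  rw [hB.norm_multipleIntegral_sq hs, mul_eq_zero] at h0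
  have h1 := h0.resolve_left (by positivity)
  exact sub_eq_zero.1 (norm_eq_zero.1 (pow_eq_zero_iff two_ne_zero |>.1 h1))

lemma MemG.isChaosExpansion_chaosKernel {lam : ℝ} {X : Lp ℝ 2 P} (hX : MemG B P lam X) :
    IsChaosExpansion B P X (chaosKernel B P X) := by
  have h : ∃ h, IsChaosExpansion B P X h := ⟨_, hX.choose_spec.1⟩
  rw [chaosKernel, dif_pos h]
  exact h.choose_spec

/-- `MemG` gives summability for some expansion, whereas `chaosKernel` is a chosen one; uniqueness
identifies them. -/
lemma MemG.summable_chaosKernel [IsProbabilityMeasure P] (hB : IsBrownianMotionOn T B P)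
    {lam : ℝ} {X : Lp ℝ 2 P} (hX : MemG B P lam X) :
    Summable fun n : ℕ => (n.factorial : ℝ) * lam ^ (2 * n) * ‖chaosKernel B P X n‖ ^ 2 := by
  obtain ⟨h, h1, h2⟩ := id hX
  rwa [hX.isChaosExpansion_chaosKernel.unique hB h1]

/-- The norm of `𝒢_λ` in terms of the kernels. -/
lemma MemG.hasSum_normG_sq [IsProbabilityMeasure P] (hB : IsBrownianMotionOn T B P)
    {lam : ℝ} {X : Lp ℝ 2 P} (hX : MemG B P lam X) :
    HasSum (fun n : ℕ => (n.factorial : ℝ) * lam ^ (2 * n) * ‖chaosKernel B P X n‖ ^ 2)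
      (normG B P lam X ^ 2) := by
  have hn : ∀ n, ‖multipleIntegral B P n (lam ^ n • chaosKernel B P X n)‖ ^ 2 =
      (n.factorial : ℝ) * lam ^ (2 * n) * ‖chaosKernel B P X n‖ ^ 2 := fun n => by
    rw [map_smul, norm_smul, mul_pow,
      hB.norm_multipleIntegral_sq (hX.isChaosExpansion_chaosKernel.1 n), Real.norm_eq_abs,
      sq_abs, ← pow_mul, mul_comm n 2]
    ring
  have ho : ∀ i j, i ≠ j → inner ℝ (multipleIntegral B P i (lam ^ i • chaosKernel B P X i))
      (multipleIntegral B P j (lam ^ j • chaosKernel B P X j)) = 0 := fun i j hij =>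
    hB.inner_multipleIntegral_of_ne hij _ _
  have hs : Summable fun n => multipleIntegral B P n (lam ^ n • chaosKernel B P X n) := by
    rw [summable_iff_of_orthogonal ho]
    simp only [hn]
    exact hX.summable_chaosKernel hB
  simpa only [hn] using! norm_tsum_sq_of_orthogonal ho hs

end Chaos

/-! ### Sections of kernels -/

section Sections

variable {T : ℝ}

lemma measurable_append (m n : ℕ) :
    Measurable fun p : (Fin n → ℝ) × (Fin m → ℝ) => Fin.append p.2 p.1 := by
  refine measurable_pi_iff.2 fun i => ?_
  induction i using Fin.addCases with
  | left i => simp only [Fin.append_left]; fun_prop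
  | right i => simp only [Fin.append_right]; fun_prop

/-- The pair is ordered `(t, s)` so that the inner integral in Tonelli runs over the section
variable `s`. -/
lemma measurePreserving_append (T : ℝ) (m n : ℕ) :
    MeasurePreserving (fun p : (Fin n → ℝ) × (Fin m → ℝ) => Fin.append p.2 p.1)
      ((cube T n).prod (cube T m)) (cube T (m + n)) where
  measurable := measurable_append m n
  map_eq := by
    refine (Measure.pi_eq fun s hs => ?_).symm
    rw [Measure.map_apply (measurable_append m n) (MeasurableSet.univ_pi hs)]
    have h : (fun p : (Fin n → ℝ) × (Fin m → ℝ) => Fin.append p.2 p.1) ⁻¹' Set.univ.pi s =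
        (Set.univ.pi fun i => s (Fin.natAdd m i)) ×ˢ (Set.univ.pi fun i => s (Fin.castAdd n i)) := by
      ext p
      simp only [Set.mem_preimage, Set.mem_pi, Set.mem_univ, true_imp_iff, Set.mem_prod]
      constructor
      · intro h
        exact ⟨fun i => by simpa using h (Fin.natAdd m i),
          fun i => by simpa using h (Fin.castAdd n i)⟩
      · rintro ⟨h1, h2⟩ i
        induction i using Fin.addCases with
        | left i => simpa using h2 i
        | right i => simpa using h1 i
    rw [h, Measure.prod_prod, cube, cube, Measure.pi_pi, Measure.pi_pi, Fin.prod_univ_add, mul_comm]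

lemma measurable_comp_append {m n : ℕ} (h : Lp ℝ 2 (cube T (m + n))) :
    Measurable fun p : (Fin n → ℝ) × (Fin m → ℝ) => h (Fin.append p.2 p.1) :=
  (Lp.stronglyMeasurable h).measurable.comp (measurable_append m n)

lemma memLp_section_iff {m n : ℕ} (h : Lp ℝ 2 (cube T (m + n))) (t : Fin n → ℝ) :
    MemLp (fun s => h (Fin.append s t)) 2 (cube T m) ↔
      ∫⁻ s, ‖h (Fin.append s t)‖ₑ ^ 2 ∂(cube T m) < ⊤ := by
  have hm : AEStronglyMeasurable (fun s => h (Fin.append s t)) (cube T m) :=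
    ((measurable_comp_append h).comp measurable_prodMk_left).aestronglyMeasurable
  have := eLpNorm_lt_top_iff_lintegral_rpow_enorm_lt_top (μ := cube T m) (p := 2)
    (f := fun s => h (Fin.append s t)) two_ne_zero ENNReal.ofNat_ne_top
  simp only [ENNReal.toReal_ofNat, ENNReal.rpow_ofNat] at this
  rw [MemLp, this]
  exact and_iff_right hm

lemma enorm_toLp_sq {α : Type*} [MeasurableSpace α] {μ : Measure α} {f : α → ℝ}
    (hf : MemLp f 2 μ) : ‖hf.toLp f‖ₑ ^ 2 = ∫⁻ x, ‖f x‖ₑ ^ 2 ∂μ := by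
  rw [Lp.enorm_toLp, eLpNorm_eq_lintegral_rpow_enorm_toReal two_ne_zero ENNReal.ofNat_ne_top]
  simp only [ENNReal.toReal_ofNat, ENNReal.rpow_ofNat]
  rw [← ENNReal.rpow_natCast, ← ENNReal.rpow_mul]
  norm_num

lemma enorm_Lp_sq {α : Type*} [MeasurableSpace α] {μ : Measure α} (f : Lp ℝ 2 μ) :
    ‖f‖ₑ ^ 2 = ∫⁻ x, ‖f x‖ₑ ^ 2 ∂μ := by
  rw [← enorm_toLp_sq (Lp.memLp f), Lp.toLp_coeFn]

lemma lintegral_lintegral_section {m n : ℕ} (h : Lp ℝ 2 (cube T (m + n))) :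
    ∫⁻ t, ∫⁻ s, ‖h (Fin.append s t)‖ₑ ^ 2 ∂(cube T m) ∂(cube T n) = ‖h‖ₑ ^ 2 := by
  have hm : Measurable fun u => ‖h u‖ₑ ^ 2 :=
    (Lp.stronglyMeasurable h).measurable.enorm.pow_const 2
  rw [enorm_Lp_sq, ← (measurePreserving_append T m n).lintegral_comp hm,
    lintegral_prod _ (by exact (hm.comp (measurable_append m n)).aemeasurable)]

lemma ae_memLp_section {m n : ℕ} (h : Lp ℝ 2 (cube T (m + n))) :
    ∀ᵐ t ∂(cube T n), MemLp (fun s => h (Fin.append s t)) 2 (cube T m) := by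
  simp only [memLp_section_iff]
  refine ae_lt_top ?_ ?_
  · exact ((measurable_comp_append h).enorm.pow_const 2).lintegral_prod_right'
  · rw [lintegral_lintegral_section]
    simp

lemma lintegral_enorm_kernelSection_sq {m n : ℕ} (h : Lp ℝ 2 (cube T (m + n))) :
    ∫⁻ t, ‖kernelSection h t‖ₑ ^ 2 ∂(cube T n) = ‖h‖ₑ ^ 2 := by
  rw [← lintegral_lintegral_section]
  refine lintegral_congr_ae ?_
  filter_upwards [ae_memLp_section h] with t ht
  rw [kernelSection, toL2, dif_pos ht, enorm_toLp_sq]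

/-- In a second countable space an open set is a countable union of balls, and preimages of balls
are sublevel sets of distances. -/
lemma measurable_of_measurable_edist {α E : Type*} [MeasurableSpace α] [PseudoEMetricSpace E]
    [SecondCountableTopology E] [MeasurableSpace E] [BorelSpace E] {f : α → E}
    (hf : ∀ y, Measurable fun x => edist (f x) y) : Measurable f := by
  refine measurable_of_isOpen fun U hU => ?_
  have hr : ∀ x : E, ∃ r : ENNReal, x ∈ U → 0 < r ∧ Metric.eball x r ⊆ U := fun x => by
    by_cases hx : x ∈ U
    · obtain ⟨r, h1, h2⟩ := EMetric.isOpen_iff.1 hU x hx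
      exact ⟨r, fun _ => ⟨h1, h2⟩⟩
    · exact ⟨0, fun h => absurd h hx⟩
  choose r hr using hr
  obtain ⟨C, hC, hCU⟩ := TopologicalSpace.isOpen_iUnion_countable
    (fun x : U => Metric.eball (x : E) (r x)) fun x => Metric.isOpen_eball
  have hU' : U = ⋃ x ∈ C, Metric.eball (x : E) (r x) := by
    rw [hCU]
    refine Set.Subset.antisymm (fun x hx => ?_) (Set.iUnion_subset fun x => (hr x x.2).2)
    exact Set.mem_iUnion.2 ⟨⟨x, hx⟩, Metric.mem_eball_self (hr x hx).1⟩
  rw [hU', Set.preimage_iUnion₂]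
  exact MeasurableSet.biUnion hC fun x _ => measurableSet_lt (hf x) measurable_const

/-- `L²` is separable, so distances to a fixed `y` suffice; their squares are partial integrals,
measurable in `t` by Tonelli. -/
lemma stronglyMeasurable_kernelSection {m n : ℕ} (h : Lp ℝ 2 (cube T (m + n))) :
    StronglyMeasurable fun t : Fin n → ℝ => (kernelSection h t : Lp ℝ 2 (cube T m)) := by
  borelize ↥(Lp ℝ 2 (cube T m))
  have : Fact ((2 : ENNReal) ≠ ⊤) := ⟨ENNReal.ofNat_ne_top⟩
  refine Measurable.stronglyMeasurable (measurable_of_measurable_edist fun y => ?_)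
  have hA : MeasurableSet {t : Fin n → ℝ | MemLp (fun s => h (Fin.append s t)) 2 (cube T m)} := by
    simp only [memLp_section_iff]
    exact measurableSet_lt
      ((measurable_comp_append h).enorm.pow_const 2).lintegral_prod_right' measurable_const
  have hsq : Measurable fun t : Fin n → ℝ => edist (kernelSection h t) y ^ 2 := by
    have h1 : (fun t : Fin n → ℝ => edist (kernelSection h t) y ^ 2) =
        -- Where the section is not square integrable, `toL2` returns `0` and the distance is
        -- constant.
        fun t => open Classical in
          if MemLp (fun s => h (Fin.append s t)) 2 (cube T m) then
            ∫⁻ s, ‖h (Fin.append s t) - y s‖ₑ ^ 2 ∂(cube T m) else edist 0 y ^ 2 := by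
      funext t
      split_ifs with ht
      · rw [kernelSection, toL2, dif_pos ht, edist_eq_enorm_sub, enorm_Lp_sq]
        refine lintegral_congr_ae ?_
        filter_upwards [Lp.coeFn_sub (ht.toLp _) y, ht.coeFn_toLp] with s h1 h2
        rw [h1, Pi.sub_apply, h2]
      · rw [kernelSection, toL2, dif_neg ht]
    rw [h1]
    refine Measurable.ite hA ?_ measurable_const
    exact (((measurable_comp_append h).sub ((Lp.stronglyMeasurable y).measurable.comp
      measurable_snd)).enorm.pow_const 2).lintegral_prod_right'
  have h2 : (fun t : Fin n → ℝ => edist (kernelSection h t) y) =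
      fun t => (edist (kernelSection h t) y ^ 2) ^ (1 / 2 : ℝ) := by
    funext t
    rw [← ENNReal.rpow_natCast, ← ENNReal.rpow_mul]
    norm_num
  rw [h2]
  exact hsq.pow_const _

/-- The permutation of the first `m` among `m + n` variables. -/
def permLeft {m : ℕ} (n : ℕ) (σ : Equiv.Perm (Fin m)) : Equiv.Perm (Fin (m + n)) :=
  finSumFinEquiv.permCongr (Equiv.sumCongr σ (Equiv.refl (Fin n)))

lemma append_comp_perm {m n : ℕ} (σ : Equiv.Perm (Fin m)) (s : Fin m → ℝ) (t : Fin n → ℝ) :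
    Fin.append (s ∘ σ) t = Fin.append s t ∘ permLeft n σ := by
  funext i
  induction i using Fin.addCases with
  | left i => simp [permLeft, Equiv.permCongr_apply]
  | right i => simp [permLeft, Equiv.permCongr_apply]

/-- Fubini gives a null set of `t` for each permutation, and there are finitely many. Symmetry of
sections is what allows the `m!` isometry inside the derivative. -/
lemma IsSymmetric.ae_kernelSection {m n : ℕ} {h : Lp ℝ 2 (cube T (m + n))} (hh : IsSymmetric h) :
    ∀ᵐ t ∂(cube T n), IsSymmetric (kernelSection h t : Lp ℝ 2 (cube T m)) := by
  have h1 : ∀ᵐ t ∂(cube T n), ∀ σ : Equiv.Perm (Fin m), ∀ᵐ s ∂(cube T m),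
      h (Fin.append (s ∘ σ) t) = h (Fin.append s t) := by
    rw [ae_all_iff]
    intro σ
    refine Measure.ae_ae_of_ae_prod (p := fun p : (Fin n → ℝ) × (Fin m → ℝ) =>
      h (Fin.append (p.2 ∘ σ) p.1) = h (Fin.append p.2 p.1)) ?_
    have := (measurePreserving_append T m n).quasiMeasurePreserving.ae (hh (permLeft n σ))
    filter_upwards [this] with p hp
    rw [append_comp_perm]
    exact hp
  filter_upwards [h1, ae_memLp_section h] with t ht hm σ
  rw [kernelSection, toL2, dif_pos hm]
  refine ((measurePreserving_comp_perm T σ).quasiMeasurePreserving.ae_eq_comp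
    hm.coeFn_toLp).trans ?_
  exact Filter.EventuallyEq.trans (ht σ) hm.coeFn_toLp.symm

end Sections

/-! ### Energy of the Hida–Malliavin derivatives -/

section Derivatives

variable {Ω : Type*} [MeasurableSpace Ω] {P : Measure Ω} {T : ℝ} {B : Set.Icc (0 : ℝ) T → Ω → ℝ}
  {X Y : Lp ℝ 2 P} {lam : ℝ}

lemma ofReal_norm_sq {E : Type*} [NormedAddCommGroup E] (x : E) :
    ENNReal.ofReal (‖x‖ ^ 2) = ‖x‖ₑ ^ 2 := by
  rw [ENNReal.ofReal_pow (norm_nonneg x), ofReal_norm]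

lemma IsBrownianMotionOn.enorm_multipleIntegral_sq [IsProbabilityMeasure P]
    (hB : IsBrownianMotionOn T B P) {n : ℕ} {h : Lp ℝ 2 (cube T n)} (hh : IsSymmetric h) :
    ‖multipleIntegral B P n h‖ₑ ^ 2 = n.factorial * ‖h‖ₑ ^ 2 := by
  rw [← ofReal_norm_sq, hB.norm_multipleIntegral_sq hh, ENNReal.ofReal_mul (by positivity),
    ENNReal.ofReal_natCast, ofReal_norm_sq]

lemma inner_derivTerm_of_ne [IsProbabilityMeasure P] (hB : IsBrownianMotionOn T B P) (n : ℕ)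
    (t : Fin n → ℝ) (i j : ℕ) (hij : i ≠ j) :
    inner ℝ (derivTerm B P X n t i) (derivTerm B P X n t j) = 0 := by
  rw [derivTerm, derivTerm, inner_smul_left, inner_smul_right,
    hB.inner_multipleIntegral_of_ne hij, mul_zero, mul_zero]

lemma stronglyMeasurable_derivTerm (X : Lp ℝ 2 P) (n m : ℕ) :
    StronglyMeasurable fun t => derivTerm B P X n t m :=
  ((multipleIntegral B P m).continuous.comp_stronglyMeasurable
    (stronglyMeasurable_kernelSection (chaosKernel B P X (m + n)))).const_smul
      ((m + n).descFactorial n : ℝ)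

/-- The left side is the squared derivative coefficient times the isometry constant. The factor `n!`
on the right cancels the `1/n!` of the series. -/
lemma descFactorial_sq_mul_factorial (m n : ℕ) :
    (m + n).descFactorial n ^ 2 * m.factorial =
      n.factorial * ((m + n).factorial * (m + n).choose n) := by
  have h1 := Nat.factorial_mul_descFactorial (Nat.le_add_left n m)
  have h2 := Nat.descFactorial_eq_factorial_mul_choose (m + n) n
  rw [Nat.add_sub_cancel] at h1
  rw [← h1, pow_two]
  nth_rw 1 [h2]
  ring

lemma MemG.lintegral_enorm_derivTerm_sq [IsProbabilityMeasure P] (hB : IsBrownianMotionOn T B P)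
    (hX : MemG B P lam X) (n m : ℕ) :
    ∫⁻ t, ‖derivTerm B P X n t m‖ₑ ^ 2 ∂(cube T n) = n.factorial *
      ((m + n).factorial * (m + n).choose n * ‖chaosKernel B P X (m + n)‖ₑ ^ 2) := by
  have h1 : ∀ᵐ t ∂(cube T n), ‖derivTerm B P X n t m‖ₑ ^ 2 =
      ((((m + n).descFactorial n ^ 2 * m.factorial : ℕ)) : ENNReal) *
        ‖(kernelSection (chaosKernel B P X (m + n)) t : Lp ℝ 2 (cube T m))‖ₑ ^ 2 := by
    filter_upwards [(hX.isChaosExpansion_chaosKernel.1 (m + n)).ae_kernelSection] with t ht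
    rw [derivTerm, enorm_smul, mul_pow, hB.enorm_multipleIntegral_sq ht,
      ← ofReal_norm (_ : ℝ), Real.norm_natCast, ENNReal.ofReal_natCast]
    push_cast
    ring
  rw [lintegral_congr_ae h1, lintegral_const_mul' _ _ (ENNReal.natCast_ne_top _),
    lintegral_enorm_kernelSection_sq, descFactorial_sq_mul_factorial]
  push_cast
  ring

/-- The number `(1/n!) ∫ ‖Dⁿ_t X‖² dt`, in terms of the kernels of `X`. -/
noncomputable def derivEnergy (B : Set.Icc (0 : ℝ) T → Ω → ℝ) (P : Measure Ω) (X : Lp ℝ 2 P)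
    (n : ℕ) : ENNReal :=
  ∑' m : ℕ, (m + n).factorial * (m + n).choose n * ‖chaosKernel B P X (m + n)‖ₑ ^ 2

/-- Grouping the nonnegative double series by `k = m + n` leaves `∑ C(k,n) = 2^k = (√2)^(2k)`: this
is where `√2` comes from. -/
lemma MemG.tsum_derivEnergy [IsProbabilityMeasure P] (hB : IsBrownianMotionOn T B P)
    (hX : MemG B P (Real.sqrt 2) X) :
    ∑' n, derivEnergy B P X n = ENNReal.ofReal (normG B P (Real.sqrt 2) X ^ 2) := by
  have hs := hX.hasSum_normG_sq hB
  rw [← hs.tsum_eq, ENNReal.ofReal_tsum_of_nonneg (fun n => by positivity) hs.summable]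
  simp only [derivEnergy]
  rw [ENNReal.tsum_comm, ← ENNReal.tsum_prod (f := fun m n : ℕ => ((m + n).factorial : ENNReal) *
    (m + n).choose n * ‖chaosKernel B P X (m + n)‖ₑ ^ 2),
    ← Finset.HasAntidiagonal.sigmaAntidiagonalEquivProd.tsum_eq, ENNReal.tsum_sigma']
  refine tsum_congr fun k => ?_
  have h1 : ∀ x : ↥(Finset.HasAntidiagonal.antidiagonal k),
      (((x : ℕ × ℕ).1 + (x : ℕ × ℕ).2).factorial : ENNReal) *
        ((x : ℕ × ℕ).1 + (x : ℕ × ℕ).2).choose (x : ℕ × ℕ).2 *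
        ‖chaosKernel B P X ((x : ℕ × ℕ).1 + (x : ℕ × ℕ).2)‖ₑ ^ 2 =
      (k.factorial : ENNReal) * k.choose (x : ℕ × ℕ).2 * ‖chaosKernel B P X k‖ₑ ^ 2 := fun x => by
    rw [Finset.HasAntidiagonal.mem_antidiagonal.1 x.2]
  refine (tsum_congr h1).trans ?_
  rw [ENNReal.tsum_mul_right, ENNReal.tsum_mul_left, tsum_fintype,
    Finset.univ_eq_attach, Finset.sum_attach (Finset.HasAntidiagonal.antidiagonal k)
      (fun x : ℕ × ℕ => (k.choose x.2 : ENNReal)),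
    ← Finset.Nat.sum_antidiagonal_swap]
  have h2 : ∑ x ∈ Finset.HasAntidiagonal.antidiagonal k, ((k.choose x.swap.2 : ℕ) : ENNReal) = 2 ^ k := by
    rw [Finset.Nat.sum_antidiagonal_eq_sum_range_succ_mk]
    have := Nat.sum_range_choose k
    exact_mod_cast this
  rw [h2, ENNReal.ofReal_mul (by positivity), ENNReal.ofReal_mul (by positivity), ofReal_norm_sq,
    ENNReal.ofReal_natCast, pow_mul, Real.sq_sqrt zero_le_two, ENNReal.ofReal_pow zero_le_two,
    ENNReal.ofReal_ofNat]

lemma MemG.derivEnergy_ne_top [IsProbabilityMeasure P] (hB : IsBrownianMotionOn T B P)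
    (hX : MemG B P (Real.sqrt 2) X) (n : ℕ) : derivEnergy B P X n ≠ ⊤ :=
  ENNReal.ne_top_of_tsum_ne_top (by rw [hX.tsum_derivEnergy hB]; exact ENNReal.ofReal_ne_top) n

lemma MemG.lintegral_tsum_derivTerm [IsProbabilityMeasure P] (hB : IsBrownianMotionOn T B P)
    (hX : MemG B P lam X) (n : ℕ) :
    ∫⁻ t, ∑' m, ‖derivTerm B P X n t m‖ₑ ^ 2 ∂(cube T n) =
      n.factorial * derivEnergy B P X n := by
  rw [lintegral_tsum fun m =>
    ((stronglyMeasurable_derivTerm X n m).enorm.pow_const 2).aemeasurable]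
  simp only [hX.lintegral_enorm_derivTerm_sq hB, ENNReal.tsum_mul_left, derivEnergy]

/-- The series that defines the `n`-th derivative converges almost everywhere. -/
lemma MemG.ae_summable_derivTerm [IsProbabilityMeasure P] (hB : IsBrownianMotionOn T B P)
    (hX : MemG B P (Real.sqrt 2) X) (n : ℕ) :
    ∀ᵐ t ∂(cube T n), Summable (derivTerm B P X n t) := by
  have h1 : ∀ᵐ t ∂(cube T n), ∑' m, ‖derivTerm B P X n t m‖ₑ ^ 2 < ⊤ := by
    refine ae_lt_top (Measurable.tsum fun m =>
      (stronglyMeasurable_derivTerm X n m).enorm.pow_const 2) ?_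
    rw [hX.lintegral_tsum_derivTerm hB]
    exact ENNReal.mul_ne_top (ENNReal.natCast_ne_top _) (hX.derivEnergy_ne_top hB n)
  filter_upwards [h1] with t ht
  rw [summable_iff_of_orthogonal (inner_derivTerm_of_ne hB n t)]
  simpa using ENNReal.summable_toReal ht.ne

lemma MemG.aestronglyMeasurable_malliavinDeriv [IsProbabilityMeasure P]
    (hB : IsBrownianMotionOn T B P) (hX : MemG B P (Real.sqrt 2) X) (n : ℕ) :
    AEStronglyMeasurable (malliavinDeriv B P X n) (cube T n) := by
  refine aestronglyMeasurable_of_tendsto_ae Filter.atTop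
    (f := fun N t => ∑ m ∈ Finset.range N, derivTerm B P X n t m) (fun N => ?_) ?_
  · exact (Finset.stronglyMeasurable_fun_sum _ fun m _ =>
      stronglyMeasurable_derivTerm X n m).aestronglyMeasurable
  · filter_upwards [hX.ae_summable_derivTerm hB n] with t ht
    exact ht.hasSum.tendsto_sum_nat

lemma MemG.lintegral_enorm_malliavinDeriv_sq [IsProbabilityMeasure P]
    (hB : IsBrownianMotionOn T B P) (hX : MemG B P (Real.sqrt 2) X) (n : ℕ) :
    ∫⁻ t, ‖malliavinDeriv B P X n t‖ₑ ^ 2 ∂(cube T n) = n.factorial * derivEnergy B P X n := by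
  rw [← hX.lintegral_tsum_derivTerm hB]
  refine lintegral_congr_ae ?_
  filter_upwards [hX.ae_summable_derivTerm hB n] with t ht
  have h1 := norm_tsum_sq_of_orthogonal (inner_derivTerm_of_ne hB n t) ht
  rw [malliavinDeriv, ← ofReal_norm_sq, ← h1.tsum_eq,
    ENNReal.ofReal_tsum_of_nonneg (fun _ => by positivity) h1.summable]
  simp only [ofReal_norm_sq]

lemma MemG.memLp_malliavinDeriv [IsProbabilityMeasure P]
    (hB : IsBrownianMotionOn T B P) (hX : MemG B P (Real.sqrt 2) X) (n : ℕ) :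
    MemLp (malliavinDeriv B P X n) 2 (cube T n) := by
  refine ⟨hX.aestronglyMeasurable_malliavinDeriv hB n, ?_⟩
  rw [eLpNorm_lt_top_iff_lintegral_rpow_enorm_lt_top two_ne_zero ENNReal.ofNat_ne_top]
  simp only [ENNReal.toReal_ofNat, ENNReal.rpow_ofNat]
  rw [hX.lintegral_enorm_malliavinDeriv_sq hB]
  exact ENNReal.mul_lt_top (ENNReal.natCast_lt_top _) (hX.derivEnergy_ne_top hB n).lt_top

lemma MemG.integral_norm_malliavinDeriv_sq [IsProbabilityMeasure P]
    (hB : IsBrownianMotionOn T B P) (hX : MemG B P (Real.sqrt 2) X) (n : ℕ) :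
    ∫ t, ‖malliavinDeriv B P X n t‖ ^ 2 ∂(cube T n) =
      n.factorial * (derivEnergy B P X n).toReal := by
  rw [integral_eq_lintegral_of_nonneg_ae (Filter.Eventually.of_forall fun _ => by positivity)
    (by exact (hX.aestronglyMeasurable_malliavinDeriv hB n).norm.pow 2)]
  simp only [ofReal_norm_sq]
  rw [hX.lintegral_enorm_malliavinDeriv_sq hB, ENNReal.toReal_mul, ENNReal.toReal_natCast]

lemma MemG.hasSum_derivEnergy [IsProbabilityMeasure P] (hB : IsBrownianMotionOn T B P)
    (hX : MemG B P (Real.sqrt 2) X) :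
    HasSum (fun n => (derivEnergy B P X n).toReal) (normG B P (Real.sqrt 2) X ^ 2) := by
  have h := hX.tsum_derivEnergy hB
  have h1 : ∑' n, derivEnergy B P X n ≠ ⊤ := by rw [h]; exact ENNReal.ofReal_ne_top
  have h2 := (ENNReal.summable_toReal h1).hasSum
  rwa [← ENNReal.tsum_toReal_eq (hX.derivEnergy_ne_top hB), h,
    ENNReal.toReal_ofReal (sq_nonneg _)] at h2

lemma norm_derivProduct_le (n : ℕ) (t : Fin n → ℝ) :
    ‖derivProduct B P X Y n t‖ ≤ ‖malliavinDeriv B P X n t‖ * ‖malliavinDeriv B P Y n t‖ := by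
  refine (ContinuousLinearMap.norm_holder_apply_apply_le _ _ _).trans_eq ?_
  rw [ContinuousLinearMap.opNorm_mul, one_mul]

lemma MemG.integrable_norm_mul_norm [IsProbabilityMeasure P] (hB : IsBrownianMotionOn T B P)
    (hX : MemG B P (Real.sqrt 2) X) (hY : MemG B P (Real.sqrt 2) Y) (n : ℕ) :
    Integrable (fun t => ‖malliavinDeriv B P X n t‖ * ‖malliavinDeriv B P Y n t‖) (cube T n) :=
  (hX.memLp_malliavinDeriv hB n).norm.integrable_mul (hY.memLp_malliavinDeriv hB n).norm

lemma MemG.integrable_derivProduct [IsProbabilityMeasure P] (hB : IsBrownianMotionOn T B P)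
    (hX : MemG B P (Real.sqrt 2) X) (hY : MemG B P (Real.sqrt 2) Y) (n : ℕ) :
    Integrable (derivProduct B P X Y n) (cube T n) := by
  refine (hX.integrable_norm_mul_norm hB hY n).mono' ?_
    (Filter.Eventually.of_forall fun t => norm_derivProduct_le n t)
  exact ((ContinuousLinearMap.mul ℝ ℝ).holderL P 2 2 1).aestronglyMeasurable_comp₂
    (hX.aestronglyMeasurable_malliavinDeriv hB n) (hY.aestronglyMeasurable_malliavinDeriv hB n)

/-- Cauchy–Schwarz in `Ω` under the integral, then in `t`; both energies carry a factor `n!`, and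
`√n! · √n!` cancels the prefactor. -/
lemma MemG.norm_antiWickTerm_le [IsProbabilityMeasure P] (hB : IsBrownianMotionOn T B P)
    (hX : MemG B P (Real.sqrt 2) X) (hY : MemG B P (Real.sqrt 2) Y) (n : ℕ) :
    ‖antiWickTerm B P X Y n‖ ≤
      Real.sqrt (derivEnergy B P X n).toReal * Real.sqrt (derivEnergy B P Y n).toReal := by
  have h1 : ‖∫ t, derivProduct B P X Y n t ∂(cube T n)‖ ≤
      ∫ t, ‖malliavinDeriv B P X n t‖ * ‖malliavinDeriv B P Y n t‖ ∂(cube T n) :=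
    norm_integral_le_of_norm_le (hX.integrable_norm_mul_norm hB hY n)
      (Filter.Eventually.of_forall fun t => norm_derivProduct_le n t)
  have h2 := integral_mul_le_Lp_mul_Lq_of_nonneg (μ := cube T n) Real.HolderConjugate.two_two
    (Filter.Eventually.of_forall fun t => norm_nonneg (malliavinDeriv B P X n t))
    (Filter.Eventually.of_forall fun t => norm_nonneg (malliavinDeriv B P Y n t))
    (by simpa using (hX.memLp_malliavinDeriv hB n).norm)
    (by simpa using (hY.memLp_malliavinDeriv hB n).norm)
  simp only [Real.rpow_two, ← Real.sqrt_eq_rpow, hX.integral_norm_malliavinDeriv_sq hB,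
    hY.integral_norm_malliavinDeriv_sq hB] at h2
  rw [Real.sqrt_mul (by positivity), Real.sqrt_mul (by positivity), mul_mul_mul_comm,
    Real.mul_self_sqrt (by positivity)] at h2
  rw [antiWickTerm, norm_smul, Real.norm_of_nonneg (by positivity)]
  calc _ ≤ 1 / (n.factorial : ℝ) * (n.factorial * (Real.sqrt (derivEnergy B P X n).toReal *
        Real.sqrt (derivEnergy B P Y n).toReal)) := by gcongr; exact h1.trans h2
    _ = _ := by field_simp

end Derivatives

end WienerChaos

/-! ### Convergence of the anti-Wick series -/

theorem lemma3p4 {Ω : Type*} [MeasurableSpace Ω] (P : Measure Ω) [IsProbabilityMeasure P]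
    (T : ℝ) (hT : 0 < T) (B : Set.Icc (0 : ℝ) T → Ω → ℝ) (hB : IsBrownianMotionOn T B P)
    (X Y : Lp ℝ 2 P) (hX : MemG B P (Real.sqrt 2) X) (hY : MemG B P (Real.sqrt 2) Y) :
    -- the derivatives and the integrals in the series are well defined
    (∀ n : ℕ, ∀ᵐ t ∂(cube T n),
      Summable (derivTerm B P X n t) ∧ Summable (derivTerm B P Y n t)) ∧
    (∀ n : ℕ, Integrable (derivProduct B P X Y n) (cube T n)) ∧
    -- the series converges in `L¹(Ω)`, with the norm bound
    Summable (antiWickTerm B P X Y) ∧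
    ‖∑' n : ℕ, antiWickTerm B P X Y n‖ ≤ normG B P (Real.sqrt 2) X * normG B P (Real.sqrt 2) Y := by
  have hsX := hX.hasSum_derivEnergy hB
  have hsY := hY.hasSum_derivEnergy hB
  have hsum : Summable fun n => Real.sqrt (derivEnergy B P X n).toReal *
      Real.sqrt (derivEnergy B P Y n).toReal := by
    refine Summable.of_nonneg_of_le (fun n => by positivity) (fun n => ?_)
      (hsX.summable.add hsY.summable)
    -- `√a √b ≤ a + b`, from `(√a - √b)² ≥ 0`.
    nlinarith [Real.sq_sqrt (ENNReal.toReal_nonneg (a := derivEnergy B P X n)),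
      Real.sq_sqrt (ENNReal.toReal_nonneg (a := derivEnergy B P Y n)),
      sq_nonneg (Real.sqrt (derivEnergy B P X n).toReal - Real.sqrt (derivEnergy B P Y n).toReal),
      ENNReal.toReal_nonneg (a := derivEnergy B P X n),
      ENNReal.toReal_nonneg (a := derivEnergy B P Y n)]
  refine ⟨fun n => (hX.ae_summable_derivTerm hB n).and (hY.ae_summable_derivTerm hB n),
    hX.integrable_derivProduct hB hY,
    Summable.of_norm_bounded hsum (hX.norm_antiWickTerm_le hB hY), ?_⟩
  refine (tsum_of_norm_bounded hsum.hasSum (hX.norm_antiWickTerm_le hB hY)).trans ?_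
  -- Cauchy–Schwarz in `n`: the two sums of energies are exactly the squared norms.
  have h2 := Real.inner_le_Lp_mul_Lq_tsum_of_nonneg Real.HolderConjugate.two_two
    (f := fun n => Real.sqrt (derivEnergy B P X n).toReal)
    (g := fun n => Real.sqrt (derivEnergy B P Y n).toReal)
    (fun n => Real.sqrt_nonneg _) (fun n => Real.sqrt_nonneg _)
    (by simpa using hsX.summable) (by simpa using hsY.summable)
  simp only [Real.rpow_two, Real.sq_sqrt ENNReal.toReal_nonneg, hsX.tsum_eq, hsY.tsum_eq,
    ← Real.sqrt_eq_rpow] at h2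
  rwa [Real.sqrt_sq (show 0 ≤ normG B P (Real.sqrt 2) X from norm_nonneg _),
    Real.sqrt_sq (show 0 ≤ normG B P (Real.sqrt 2) Y from norm_nonneg _)] at h2
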